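/- Let $M^n\subset\mathbb R^{n+1}$ be a smooth embedded hypersurface with smooth unit normal field $N$, induced metric $g$, shape operator $S(X)=-\bar\nabla_X N$, and Ricci endomorphism $\mathrm{Ric}^{(n)}$. In local coordinates $x=(x^1,\dots,x^n)$ on $M$, given by a local parametrization $\varphi$, use Fermi coordinates $(r,x)\mapsto \varphi(x)+rN(\varphi(x))$ near $M$, with $\partial_i=\partial_i\varphi+r\,\partial_i(N\circ\varphi)$ and $g_{ij}(r,x)=\langle\partial_i,\partial_j\rangle$. For an ambient vector field $X$ write $X_i=\langle X,\partial_i\rangle$ and $X^i=g^{ij}(r,x)X_j$ for its covariant and contravariant tangential components. Let $U$ be a vector field of class $C^2$ on an open neighbourhood of $M$ that is tangential to $M$ along $M$ and satisfies the Hodge (zero tangential vorticity) condition: near $r=0$ on every normal line to $M$, the covariant tangential components are constant in the normal direction, $\partial_r U_i=0$. Then the tangential vorticity $(dU^\flat)(N,\partial_i\varphi)$ vanishes on $M$, and at $r=0$ $$\partial_r U^i = 2S^i{}_jU^j,\qquad \partial_r^2U^i=6(S^2)^i{}_jU^j .$$ Moreover, the tangential part of the ambient Bochner (componentwise Euclidean)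 Laplacian satisfies $$(\Delta_B^{(n+1)}U)^i\big|_{r=0}=(\Delta_H^{(n)}u)^i=(\Delta_B^{(n)}u)^i-\mathrm{Ric}^{(n)i}{}_k\,u^k,$$ where $u=U|_M$, $\Delta_B^{(n)}=g^{jk}\nabla_j\nabla_k$ is the Bochner Laplacian of $(M,g)$ and $\Delta_H^{(n)}u=-\big((d\delta+\delta d)u^\flat\big)^\sharp$ its Hodge Laplacian; and in the thin-shell limit $r\to0$ the components $(\Delta_B^{(n+1)}U)^i(r,x)$ converge to $(\Delta_H^{(n)}u)^i(x)$ locally uniformly in $x$. -/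

import Mathlib

open scoped Topology ContDiff

noncomputable section

namespace ThinShell

/-- Euclidean space `ℝⁿ⁺¹`. -/
abbrev Amb (n : ℕ) := EuclideanSpace ℝ (Fin (n + 1))

/-- The coordinate space `ℝⁿ`. -/
abbrev Coord (n : ℕ) := Fin n → ℝ

/-- The partial derivative `∂ᵢ f` at `x`. -/
def pd {n : ℕ} {F : Type*} [NormedAddCommGroup F] [NormedSpace ℝ F]
    (i : Fin n) (f : Coord n → F) (x : Coord n) : F :=
  fderiv ℝ f x (Pi.single i 1)

/-! ## Riemannian geometry in coordinates

`g` is a metric `g_{ij}`, `u` a vector field with components `uⁱ`, `w` a one-form with components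
`wᵢ`, `b` a two-tensor with components `b_{ij}`, everything as functions of the coordinates. -/

section Intrinsic

variable {n : ℕ}

/-- The Christoffel symbol `Γᵏ_{ij} = ½ gᵏˡ (∂ᵢ g_{jl} + ∂ⱼ g_{il} - ∂ₗ g_{ij})`. -/
def christoffel (g : Coord n → Matrix (Fin n) (Fin n) ℝ) (k i j : Fin n) (x : Coord n) : ℝ :=
  (1 / 2 : ℝ) * ∑ l, (g x)⁻¹ k l *
    (pd i (fun y => g y j l) x + pd j (fun y => g y i l) x - pd l (fun y => g y i j) x)

/-- The covariant derivative `∇ⱼ uⁱ` of a vector field. -/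
def covVec (g : Coord n → Matrix (Fin n) (Fin n) ℝ) (u : Coord n → Fin n → ℝ)
    (j i : Fin n) (x : Coord n) : ℝ :=
  pd j (fun y => u y i) x + ∑ l, christoffel g i j l x * u x l

/-- The second covariant derivative `∇ⱼ∇ₖ uⁱ` of a vector field. -/
def covVec2 (g : Coord n → Matrix (Fin n) (Fin n) ℝ) (u : Coord n → Fin n → ℝ)
    (j k i : Fin n) (x : Coord n) : ℝ :=
  pd j (covVec g u k i) x + ∑ l, christoffel g i j l x * covVec g u k l x
    - ∑ l, christoffel g l j k x * covVec g u l i x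

/-- The Bochner Laplacian `(Δ_B u)ⁱ = gʲᵏ ∇ⱼ∇ₖ uⁱ` of a vector field. -/
def bochner (g : Coord n → Matrix (Fin n) (Fin n) ℝ) (u : Coord n → Fin n → ℝ)
    (x : Coord n) (i : Fin n) : ℝ :=
  ∑ j, ∑ k, (g x)⁻¹ j k * covVec2 g u j k i x

/-- The Ricci tensor `Ric_{jl} = ∂ₖ Γᵏ_{lj} - ∂ₗ Γᵏ_{kj} + Γᵏ_{km} Γᵐ_{lj} - Γᵏ_{lm} Γᵐ_{kj}`
(positive on round spheres of dimension at least two). -/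
def ricci (g : Coord n → Matrix (Fin n) (Fin n) ℝ) (j l : Fin n) (x : Coord n) : ℝ :=
  ∑ k, (pd k (christoffel g k l j) x - pd l (christoffel g k k j) x
    + ∑ m, (christoffel g k k m x * christoffel g m l j x
      - christoffel g k l m x * christoffel g m k j x))

/-- The Ricci endomorphism `(Ric u)ⁱ = gⁱʲ Ric_{jk} uᵏ` on a vector field. -/
def ricciVec (g : Coord n → Matrix (Fin n) (Fin n) ℝ) (u : Coord n → Fin n → ℝ)
    (x : Coord n) (i : Fin n) : ℝ :=
  ∑ j, ∑ k, (g x)⁻¹ i j * ricci g j k x * u x k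

/-- The exterior derivative `(dw)_{ij} = ∂ᵢ wⱼ - ∂ⱼ wᵢ` of a one-form. -/
def extDer (w : Coord n → Fin n → ℝ) (x : Coord n) (i j : Fin n) : ℝ :=
  pd i (fun y => w y j) x - pd j (fun y => w y i) x

/-- The codifferential `δw = -∇ⁱ wᵢ` of a one-form. -/
def codiffOne (g : Coord n → Matrix (Fin n) (Fin n) ℝ) (w : Coord n → Fin n → ℝ)
    (x : Coord n) : ℝ :=
  -∑ i, ∑ j, (g x)⁻¹ i j * (pd i (fun y => w y j) x - ∑ l, christoffel g l i j x * w x l)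

/-- The codifferential `(δb)ⱼ = -∇ⁱ b_{ij}` of a two-form. -/
def codiffTwo (g : Coord n → Matrix (Fin n) (Fin n) ℝ) (b : Coord n → Fin n → Fin n → ℝ)
    (x : Coord n) (j : Fin n) : ℝ :=
  -∑ k, ∑ i, (g x)⁻¹ k i * (pd k (fun y => b y i j) x
    - ∑ l, christoffel g l k i x * b x l j - ∑ l, christoffel g l k j x * b x i l)

/-- Lowering the index of a vector field, `uᵢ = g_{ij} uʲ`. -/
def flat (g : Coord n → Matrix (Fin n) (Fin n) ℝ) (u : Coord n → Fin n → ℝ)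
    (x : Coord n) (i : Fin n) : ℝ :=
  ∑ j, g x i j * u x j

/-- The Hodge Laplacian of a vector field, `Δ_H u = -((dδ + δd) u♭)♯`. -/
def hodge (g : Coord n → Matrix (Fin n) (Fin n) ℝ) (u : Coord n → Fin n → ℝ)
    (x : Coord n) (i : Fin n) : ℝ :=
  -∑ j, (g x)⁻¹ i j *
    (pd j (codiffOne g (flat g u)) x + codiffTwo g (extDer (flat g u)) x j)

end Intrinsic

/-! ## Hypersurfaces and Fermi coordinates -/

section Hypersurface

variable {n : ℕ}

/-- `φ` on the open set `V` is a smooth local parametrization of `M`: a smooth immersion which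
is a homeomorphism of `V` onto a relatively open subset of `M`. -/
structure IsLocalParam (M : Set (Amb n)) (φ : Coord n → Amb n) (V : Set (Coord n)) : Prop where
  isOpen : IsOpen V
  contDiffOn : ContDiffOn ℝ ∞ φ V
  immersion : ∀ x ∈ V, Function.Injective (fderiv ℝ φ x)
  injOn : Set.InjOn φ V
  relOpen : ∀ V' ⊆ V, IsOpen V' → ∃ W : Set (Amb n), IsOpen W ∧ φ '' V' = M ∩ W

/-- `M` is a smooth embedded hypersurface of `ℝⁿ⁺¹`. -/
def IsSmoothHypersurface (M : Set (Amb n)) : Prop :=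
  ∀ p ∈ M, ∃ (φ : Coord n → Amb n) (V : Set (Coord n)), IsLocalParam M φ V ∧ p ∈ φ '' V

/-- `N` is a smooth unit normal field along `M`. -/
structure IsUnitNormal (M : Set (Amb n)) (N : Amb n → Amb n) : Prop where
  norm_eq_one : ∀ p ∈ M, ‖N p‖ = 1
  normal : ∀ φ V, IsLocalParam M φ V → ∀ x ∈ V, ∀ v, inner ℝ (N (φ x)) (fderiv ℝ φ x v) = 0
  smooth : ∀ φ V, IsLocalParam M φ V → ContDiffOn ℝ ∞ (fun x => N (φ x)) V

/-- Fermi coordinates `(r, x) ↦ φ(x) + r N(φ(x))`. -/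
def fermi (φ : Coord n → Amb n) (N : Amb n → Amb n) (r : ℝ) (x : Coord n) : Amb n :=
  φ x + r • N (φ x)

/-- The tangential coordinate vector `∂ᵢ` of Fermi coordinates. -/
def fermiVec (φ : Coord n → Amb n) (N : Amb n → Amb n) (r : ℝ) (x : Coord n) (i : Fin n) :
    Amb n :=
  pd i (fermi φ N r) x

/-- The tangential block `g_{ij}(r, x)` of the Euclidean metric in Fermi coordinates. -/
def fermiMetric (φ : Coord n → Amb n) (N : Amb n → Amb n) (r : ℝ) (x : Coord n) :
    Matrix (Fin n) (Fin n) ℝ :=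
  Matrix.of fun i j => inner ℝ (fermiVec φ N r x i) (fermiVec φ N r x j)

/-- The covariant tangential components `Xᵢ(r, x)` of an ambient vector field. -/
def lowerComp (φ : Coord n → Amb n) (N : Amb n → Amb n) (X : Amb n → Amb n)
    (r : ℝ) (x : Coord n) (i : Fin n) : ℝ :=
  inner ℝ (X (fermi φ N r x)) (fermiVec φ N r x i)

/-- The contravariant tangential components `Xⁱ(r, x) = gⁱʲ(r, x) Xⱼ(r, x)` of an ambient vector
field (the radial direction is orthogonal to the tangential ones). -/
def upperComp (φ : Coord n → Amb n) (N : Amb n → Amb n) (X : Amb n → Amb n)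
    (r : ℝ) (x : Coord n) (i : Fin n) : ℝ :=
  ∑ j, (fermiMetric φ N r x)⁻¹ i j * lowerComp φ N X r x j

/-- The induced metric `g_{ij} = ⟨∂ᵢφ, ∂ⱼφ⟩` on `M`. -/
def inducedMetric (φ : Coord n → Amb n) (x : Coord n) : Matrix (Fin n) (Fin n) ℝ :=
  Matrix.of fun i j => inner ℝ (pd i φ x) (pd j φ x)

/-- The matrix `Sⁱⱼ` of the shape operator `S(X) = -D_X N` in the basis `∂ᵢφ`. -/
def shape (φ : Coord n → Amb n) (N : Amb n → Amb n) (x : Coord n) :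
    Matrix (Fin n) (Fin n) ℝ :=
  Matrix.of fun i j => ∑ k, (inducedMetric φ x)⁻¹ i k *
    inner ℝ (-pd j (fun y => N (φ y)) x) (pd k φ x)

/-- The Hodge condition along `M`: in Fermi coordinates on a thin shell around `M` the covariant
tangential components of `U` do not depend on the normal coordinate, `∂ᵣ Uᵢ = 0`. -/
def HodgeCondition (M : Set (Amb n)) (N U : Amb n → Amb n) : Prop :=
  ∀ φ V, IsLocalParam M φ V → ∀ x ∈ V, ∀ i,
    ∀ᶠ r in 𝓝 (0 : ℝ), deriv (fun s => lowerComp φ N U s x i) r = 0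

/-- The tangential vorticity `ω_{ri} = (dU♭)(N, ∂ᵢφ)` of `U` at the point `φ(x)` of `M`. -/
def tangentialVorticity (φ : Coord n → Amb n) (N U : Amb n → Amb n) (x : Coord n) (i : Fin n) :
    ℝ :=
  inner ℝ (fderiv ℝ U (φ x) (N (φ x))) (pd i φ x)
    - inner ℝ (fderiv ℝ U (φ x) (pd i φ x)) (N (φ x))

/-- The Bochner Laplacian of a vector field for the flat connection of `ℝⁿ⁺¹`: the trace of the
second derivative, that is, the Euclidean Laplacian of each Cartesian component. -/
def ambientBochner (U : Amb n → Amb n) : Amb n → Amb n :=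
  Laplacian.laplacian U

end Hypersurface

end ThinShell

end

/-! Along the normal line through `φ x` the tangential Fermi vector is affine in `r`, namely `∂ᵢφ +
r ∂ᵢN`, so the Hodge condition says that `⟨U(φ + rN), ∂ᵢφ + r ∂ᵢN⟩` is locally constant in `r`.
Everything is read off from this.

Its first derivative at `0` gives `⟨DU(N), ∂ᵢφ⟩ + ⟨U, ∂ᵢN⟩ = 0`. Differentiating `⟨U, N⟩ = 0` along
`M` gives `⟨DU(∂ᵢφ), N⟩ + ⟨U, ∂ᵢN⟩ = 0`. Subtracting, the tangential vorticity vanishes: the mixed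
normal-tangential part of `DU` is symmetric. The second derivative gives `⟨D²U(N,N), ∂ᵢφ⟩ =
-2⟨DU(N), ∂ᵢN⟩`.

For the contravariant components, self-adjointness of `S` gives `g(r) = g(0)(1 - rS)²`
(`fermiMetric_eq`). Constancy of `Uᵢ` then becomes the implicit relation `u(r) = u(0) + 2rS u(r) -
r²S² u(r)`, and differentiating it twice at `0` yields `2S` and `8S² - 2S² = 6S²`.

For the Laplacian, `u♭` is the pullback of `U♭`. Zero vorticity removes the second fundamental form
from `∇du♭`, which becomes the antisymmetrized `D²U` (`cov_extDer_pullback`); tangency makes `δu♭`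
minus the tangential trace of `DU` (`codiffOne_pullback`). In `(dδ + δd)u♭` the mixed terms cancel,
leaving minus the tangential trace of `D²U` plus `2⟨DU(N), ∂ₘN⟩`. By the second-derivative identity
the latter is `-⟨D²U(N,N), ∂ₘφ⟩`, which completes the full trace (`inner_ambientBochner`).

The relation with `Ric` is the Weitzenböck formula, purely intrinsic. The thin-shell limit is joint
continuity in `(r, x)` at `r = 0`. -/

namespace ThinShell

/-! ### Calculus of coordinate partial derivatives. -/

section Calculus

variable {n : ℕ} {F : Type*} [NormedAddCommGroup F] [NormedSpace ℝ F] {x : Coord n} {i : Fin n}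

lemma pd_congr {f g : Coord n → F} (h : f =ᶠ[𝓝 x] g) : pd i f x = pd i g x := by
  unfold pd; rw [h.fderiv_eq]

lemma pd_congr_on {V : Set (Coord n)} (hV : IsOpen V) (hx : x ∈ V) {f g : Coord n → F}
    (h : ∀ y ∈ V, f y = g y) : pd i f x = pd i g x :=
  pd_congr (Filter.eventuallyEq_of_mem (hV.mem_nhds hx) h)

lemma pd_const (c : F) : pd i (fun _ => c) x = 0 := by simp [pd]

lemma pd_add {f g : Coord n → F} (hf : DifferentiableAt ℝ f x) (hg : DifferentiableAt ℝ g x) :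
    pd i (fun y => f y + g y) x = pd i f x + pd i g x := by
  simp [pd, fderiv_fun_add hf hg]

lemma pd_sub {f g : Coord n → F} (hf : DifferentiableAt ℝ f x) (hg : DifferentiableAt ℝ g x) :
    pd i (fun y => f y - g y) x = pd i f x - pd i g x := by
  simp [pd, fderiv_fun_sub hf hg]

lemma pd_neg {f : Coord n → F} : pd i (fun y => -f y) x = -pd i f x := by
  simp [pd, fderiv_fun_neg]

lemma pd_mul {f g : Coord n → ℝ} (hf : DifferentiableAt ℝ f x) (hg : DifferentiableAt ℝ g x) :
    pd i (fun y => f y * g y) x = pd i f x * g x + f x * pd i g x := by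
  simp [pd, fderiv_fun_mul hf hg]; ring

lemma pd_sum {ι : Type*} {s : Finset ι} {f : ι → Coord n → F}
    (hf : ∀ k ∈ s, DifferentiableAt ℝ (f k) x) :
    pd i (fun y => ∑ k ∈ s, f k y) x = ∑ k ∈ s, pd i (f k) x := by
  simp [pd, fderiv_fun_sum hf]

lemma pd_sum_mul {ι : Type*} {s : Finset ι} {f h : ι → Coord n → ℝ}
    (hf : ∀ k ∈ s, DifferentiableAt ℝ (f k) x) (hh : ∀ k ∈ s, DifferentiableAt ℝ (h k) x) :
    pd i (fun y => ∑ k ∈ s, f k y * h k y) x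
      = ∑ k ∈ s, (pd i (f k) x * h k x + f k x * pd i (h k) x) := by
  rw [pd_sum fun k hk => (hf k hk).fun_mul (hh k hk)]
  exact Finset.sum_congr rfl fun k hk => pd_mul (hf k hk) (hh k hk)

lemma pd_inner {m : ℕ} {f g : Coord n → Amb m} (hf : DifferentiableAt ℝ f x)
    (hg : DifferentiableAt ℝ g x) :
    pd i (fun y => inner ℝ (f y) (g y)) x = inner ℝ (pd i f x) (g x) + inner ℝ (f x) (pd i g x) := by
  simp [pd, fderiv_inner_apply ℝ hf hg]; ring

lemma pd_comp {E : Type*} [NormedAddCommGroup E] [NormedSpace ℝ E] {f : E → F} {φ : Coord n → E}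
    (hf : DifferentiableAt ℝ f (φ x)) (hφ : DifferentiableAt ℝ φ x) :
    pd i (fun y => f (φ y)) x = fderiv ℝ f (φ x) (pd i φ x) := by
  unfold pd
  rw [fderiv_fun_comp x hf hφ]; rfl

lemma contDiffAt_pd {f : Coord n → F} {m k : ℕ∞ω} (hf : ContDiffAt ℝ k f x) (hm : m + 1 ≤ k) :
    ContDiffAt ℝ m (pd i f) x :=
  (hf.fderiv_right hm).clm_apply contDiffAt_const

lemma pd_comm {f : Coord n → F} (hf : ContDiffAt ℝ 2 f x) (i j : Fin n) :
    pd i (pd j f) x = pd j (pd i f) x := by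
  have hd : DifferentiableAt ℝ (fderiv ℝ f) x :=
    (hf.fderiv_right (m := 1) le_rfl).differentiableAt one_ne_zero
  have key : ∀ i j, pd i (pd j f) x
      = fderiv ℝ (fderiv ℝ f) x (Pi.single i 1) (Pi.single j 1) := by
    intro i j
    have : pd j f = fun y => fderiv ℝ f y (Pi.single j 1) := rfl
    unfold pd
    rw [fderiv_clm_apply hd (differentiableAt_const _)]
    simp
  rw [key, key]
  exact hf.isSymmSndFDerivAt (by simp) _ _

end Calculus

/-! ### Smooth dependence of the inverse matrix. -/

section MatrixInverse

variable {n : ℕ} {E : Type*} [NormedAddCommGroup E] [NormedSpace ℝ E] {m : ℕ∞ω} {x : E}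
  {A : E → Matrix (Fin n) (Fin n) ℝ}

lemma contDiffAt_det (hA : ∀ i j, ContDiffAt ℝ m (fun y => A y i j) x) :
    ContDiffAt ℝ m (fun y => (A y).det) x := by
  simp only [Matrix.det_apply]
  refine ContDiffAt.sum fun σ _ => ContDiffAt.const_smul _ ?_
  exact contDiffAt_prod fun i _ => hA _ _

/-- Cramer's rule: the adjugate and the determinant are polynomial in the entries, so entrywise
regularity suffices and no norm on matrices enters. -/
lemma contDiffAt_inv_apply (hA : ∀ i j, ContDiffAt ℝ m (fun y => A y i j) x)
    (hdet : (A x).det ≠ 0) (i j : Fin n) : ContDiffAt ℝ m (fun y => (A y)⁻¹ i j) x := by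
  simp only [Matrix.inv_def, Matrix.smul_apply, smul_eq_mul, Ring.inverse_eq_inv']
  refine (contDiffAt_det hA).inv hdet |>.mul ?_
  simp only [Matrix.adjugate_apply]
  refine contDiffAt_det fun k l => ?_
  by_cases hk : k = j
  · subst hk; simp only [Matrix.updateRow_self]; exact contDiffAt_const
  · simp only [Matrix.updateRow_ne hk]; exact hA k l

end MatrixInverse

/-! ### The Weitzenböck formula for vector fields in coordinates. -/

section Weitzenboeck

variable {n : ℕ} {V : Set (Coord n)} {g : Coord n → Matrix (Fin n) (Fin n) ℝ}

/-- `g` is a smooth nondegenerate symmetric tensor on the open set `V`. -/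
structure IsMetricOn (g : Coord n → Matrix (Fin n) (Fin n) ℝ) (V : Set (Coord n)) : Prop where
  isOpen : IsOpen V
  smooth : ∀ x ∈ V, ∀ i j, ContDiffAt ℝ ∞ (fun y => g y i j) x
  symm : ∀ x ∈ V, ∀ i j, g x i j = g x j i
  det_ne_zero : ∀ x ∈ V, (g x).det ≠ 0

namespace IsMetricOn

variable {x : Coord n} {u v : Coord n → Fin n → ℝ}

lemma isUnit_det (hg : IsMetricOn g V) (hx : x ∈ V) : IsUnit (g x).det :=
  (hg.det_ne_zero x hx).isUnit

lemma inv_symm (hg : IsMetricOn g V) (hx : x ∈ V) (i j : Fin n) :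
    (g x)⁻¹ i j = (g x)⁻¹ j i := by
  have h : (g x).transpose = g x := by ext a b; exact hg.symm x hx b a
  have := Matrix.transpose_nonsing_inv (g x)
  rw [h] at this
  exact congrFun (congrFun this j) i

lemma inv_mulVec_flat (hg : IsMetricOn g V) (hx : x ∈ V) (i : Fin n) :
    ∑ j, (g x)⁻¹ i j * flat g v x j = v x i := by
  have : (g x)⁻¹.mulVec ((g x).mulVec (v x)) = v x := by
    rw [Matrix.mulVec_mulVec, Matrix.nonsing_inv_mul _ (hg.isUnit_det hx), Matrix.one_mulVec]
  exact congrFun this i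

lemma sum_mul_inv (hg : IsMetricOn g V) (hx : x ∈ V) (i j : Fin n) :
    ∑ k, g x i k * (g x)⁻¹ k j = if i = j then 1 else 0 := by
  have := congrFun (congrFun (Matrix.mul_nonsing_inv (g x) (hg.isUnit_det hx)) i) j
  rwa [Matrix.mul_apply, Matrix.one_apply] at this

lemma contDiffAt_inv (hg : IsMetricOn g V) (hx : x ∈ V) (i j : Fin n) :
    ContDiffAt ℝ ∞ (fun y => (g y)⁻¹ i j) x :=
  contDiffAt_inv_apply (hg.smooth x hx) (hg.det_ne_zero x hx) i j

lemma contDiffAt_christoffel (hg : IsMetricOn g V) (hx : x ∈ V) (k i j : Fin n) :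
    ContDiffAt ℝ ∞ (christoffel g k i j) x := by
  unfold christoffel
  refine contDiffAt_const.mul (ContDiffAt.sum fun l _ => (hg.contDiffAt_inv hx _ _).mul ?_)
  exact ((contDiffAt_pd (hg.smooth x hx _ _) le_rfl).add
    (contDiffAt_pd (hg.smooth x hx _ _) le_rfl)).sub (contDiffAt_pd (hg.smooth x hx _ _) le_rfl)

lemma differentiableAt_christoffel (hg : IsMetricOn g V) (hx : x ∈ V) (k i j : Fin n) :
    DifferentiableAt ℝ (christoffel g k i j) x :=
  (hg.contDiffAt_christoffel hx k i j).differentiableAt (by simp)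

lemma contDiffAt_covVec (hg : IsMetricOn g V) (hx : x ∈ V)
    (hu : ∀ i, ContDiffAt ℝ 2 (fun y => u y i) x) (j i : Fin n) :
    ContDiffAt ℝ 1 (covVec g u j i) x := by
  unfold covVec
  refine (contDiffAt_pd (hu i) le_rfl).add (ContDiffAt.sum fun l _ => ?_)
  exact ((hg.contDiffAt_christoffel hx _ _ _).of_le (by simp)).mul ((hu l).of_le (by norm_num))

lemma pd_symm (hg : IsMetricOn g V) (hx : x ∈ V) (k i j : Fin n) :
    pd k (fun y => g y i j) x = pd k (fun y => g y j i) x :=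
  pd_congr_on hg.isOpen hx fun y hy => hg.symm y hy i j

lemma christoffel_symm (hg : IsMetricOn g V) (hx : x ∈ V) (k i j : Fin n) :
    christoffel g k i j x = christoffel g k j i x := by
  unfold christoffel
  congr 1
  refine Finset.sum_congr rfl fun l _ => ?_
  rw [hg.pd_symm hx l i j]; ring

lemma lower_christoffel (hg : IsMetricOn g V) (hx : x ∈ V) (m i j : Fin n) :
    ∑ k, g x m k * christoffel g k i j x = (1 / 2 : ℝ) *
      (pd i (fun y => g y j m) x + pd j (fun y => g y i m) x - pd m (fun y => g y i j) x) := by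
  unfold christoffel
  simp only [Finset.mul_sum]
  rw [Finset.sum_comm]
  have : ∀ l, ∑ k, g x m k * ((1 / 2 : ℝ) * ((g x)⁻¹ k l *
      (pd i (fun y => g y j l) x + pd j (fun y => g y i l) x - pd l (fun y => g y i j) x)))
      = (∑ k, g x m k * (g x)⁻¹ k l) * ((1 / 2 : ℝ) *
      (pd i (fun y => g y j l) x + pd j (fun y => g y i l) x - pd l (fun y => g y i j) x)) := by
    intro l; rw [Finset.sum_mul]; exact Finset.sum_congr rfl fun k _ => by ring
  simp only [this, hg.sum_mul_inv hx]
  simp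

/-- Metric compatibility `∇g = 0`: adding the two lowered Christoffel symbols cancels every
derivative of the metric except the one in direction `k`. -/
lemma pd_metric (hg : IsMetricOn g V) (hx : x ∈ V) (k i j : Fin n) :
    pd k (fun y => g y i j) x
      = ∑ l, (christoffel g l k i x * g x l j + christoffel g l k j x * g x i l) := by
  have h1 := hg.lower_christoffel hx j k i
  have h2 := hg.lower_christoffel hx i k j
  rw [hg.pd_symm hx k j i] at h2
  have : ∑ l, (christoffel g l k i x * g x l j + christoffel g l k j x * g x i l)
      = ∑ l, g x j l * christoffel g l k i x + ∑ l, g x i l * christoffel g l k j x := by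
    rw [← Finset.sum_add_distrib]
    exact Finset.sum_congr rfl fun l _ => by rw [hg.symm x hx l j]; ring
  rw [this, h1, h2]
  ring

/-- Lowering the index commutes with the covariant derivative. -/
lemma cov_flat (hg : IsMetricOn g V) (hx : x ∈ V)
    (hv : ∀ i, DifferentiableAt ℝ (fun y => v y i) x) (j i : Fin n) :
    pd j (fun y => flat g v y i) x - ∑ l, christoffel g l j i x * flat g v x l
      = ∑ m, g x i m * covVec g v j m x := by
  have hgd : ∀ i j, DifferentiableAt ℝ (fun y => g y i j) x := fun i j =>
    (hg.smooth x hx i j).differentiableAt (by simp)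
  have h1 : pd j (fun y => flat g v y i) x
      = ∑ m, (pd j (fun y => g y i m) x * v x m + g x i m * pd j (fun y => v y m) x) := by
    exact pd_sum_mul (fun m _ => hgd i m) fun m _ => hv m
  rw [h1]
  simp only [hg.pd_metric hx, covVec, flat, Finset.sum_add_distrib, add_mul, mul_add,
    Finset.sum_mul, Finset.mul_sum]
  have h2 : ∑ l, ∑ m, christoffel g l j i x * (g x l m * v x m)
      = ∑ m, ∑ l, christoffel g l j i x * g x l m * v x m := by
    rw [Finset.sum_comm]
    exact Finset.sum_congr rfl fun _ _ => Finset.sum_congr rfl fun _ _ => by ring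
  have h3 : ∑ m, ∑ l, g x i m * (christoffel g m j l x * v x l)
      = ∑ m, ∑ l, christoffel g l j m x * g x i l * v x m := by
    rw [Finset.sum_comm]
    exact Finset.sum_congr rfl fun _ _ => Finset.sum_congr rfl fun _ _ => by ring
  rw [h2, h3]; ring

lemma codiffOne_flat (hg : IsMetricOn g V) (hx : x ∈ V)
    (hv : ∀ i, DifferentiableAt ℝ (fun y => v y i) x) :
    codiffOne g (flat g v) x = -∑ i, covVec g v i i x := by
  unfold codiffOne
  congr 1
  refine Finset.sum_congr rfl fun i _ => ?_
  simp only [hg.cov_flat hx hv]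
  exact hg.inv_mulVec_flat (v := fun y m => covVec g v i m y) hx i

/-- Torsion-freeness: the Christoffel corrections are symmetric in `i, j` and drop out of the
antisymmetrization. -/
lemma extDer_flat (hg : IsMetricOn g V) (hx : x ∈ V)
    (hv : ∀ i, DifferentiableAt ℝ (fun y => v y i) x) (i j : Fin n) :
    extDer (flat g v) x i j = flat g (fun y m => covVec g v i m y) x j
      - flat g (fun y m => covVec g v j m y) x i := by
  have h1 := hg.cov_flat hx hv i j
  have h2 := hg.cov_flat hx hv j i
  simp only [hg.christoffel_symm hx _ j i] at h2
  unfold extDer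
  simp only [flat] at h1 h2 ⊢
  linarith

lemma cov_extDer_flat (hg : IsMetricOn g V) (hx : x ∈ V)
    (hu : ∀ x ∈ V, ∀ i, ContDiffAt ℝ 2 (fun y => u y i) x) (k i j : Fin n) :
    pd k (fun y => extDer (flat g u) y i j) x
        - ∑ l, christoffel g l k i x * extDer (flat g u) x l j
        - ∑ l, christoffel g l k j x * extDer (flat g u) x i l
      = ∑ m, g x j m * covVec2 g u k i m x - ∑ m, g x i m * covVec2 g u k j m x := by
  have hud : ∀ x ∈ V, ∀ i, DifferentiableAt ℝ (fun y => u y i) x := fun x hx i =>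
    (hu x hx i).differentiableAt (by simp)
  have hc : ∀ i m, DifferentiableAt ℝ (covVec g u i m) x := fun i m =>
    (hg.contDiffAt_covVec hx (hu x hx) i m).differentiableAt (by simp)
  have hgd : ∀ i j, DifferentiableAt ℝ (fun y => g y i j) x := fun i j =>
    (hg.smooth x hx i j).differentiableAt (by simp)
  have hf : ∀ i j, DifferentiableAt ℝ (fun y => flat g (fun y m => covVec g u i m y) y j) x := by
    intro i j; unfold flat
    exact DifferentiableAt.fun_sum fun m _ => (hgd j m).mul (hc i m)
  rw [pd_congr_on hg.isOpen hx fun y hy => hg.extDer_flat hy (hud y hy) i j, pd_sub (hf i j) (hf j i)]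
  -- With `i` frozen, `∇ᵢuᵐ` is treated as a vector field in `m`. The correction for the lower index
  -- `i`, ignored here, is restored by `h3`.
  have h1 := hg.cov_flat (v := fun y m => covVec g u i m y) hx (hc i) k j
  have h2 := hg.cov_flat (v := fun y m => covVec g u j m y) hx (hc j) k i
  simp only [hg.extDer_flat hx (hud x hx), mul_sub, Finset.sum_sub_distrib]
  have h3 : ∀ i j, ∑ m, g x j m * covVec2 g u k i m x
      = ∑ m, g x j m * covVec g (fun y m => covVec g u i m y) k m x
        - ∑ l, christoffel g l k i x * flat g (fun y m => covVec g u l m y) x j := by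
    intro i j
    simp only [covVec2, flat, Finset.mul_sum, mul_sub, Finset.sum_sub_distrib]
    congr 1
    rw [Finset.sum_comm]
    exact Finset.sum_congr rfl fun _ _ => Finset.sum_congr rfl fun _ _ => by ring
  rw [h3, h3]
  linarith

/-- Covariant differentiation commutes with contraction: the Christoffel terms for the upper and
lower `k` cancel once summed. -/
lemma pd_codiffOne_flat (hg : IsMetricOn g V) (hx : x ∈ V)
    (hu : ∀ x ∈ V, ∀ i, ContDiffAt ℝ 2 (fun y => u y i) x) (j : Fin n) :
    pd j (codiffOne g (flat g u)) x = -∑ k, covVec2 g u j k k x := by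
  have hud : ∀ x ∈ V, ∀ i, DifferentiableAt ℝ (fun y => u y i) x := fun x hx i =>
    (hu x hx i).differentiableAt (by simp)
  rw [pd_congr_on hg.isOpen hx fun y hy => hg.codiffOne_flat hy (hud y hy), pd_neg,
    pd_sum fun i _ => (hg.contDiffAt_covVec hx (hu x hx) i i).differentiableAt (by simp)]
  simp only [covVec2, Finset.sum_sub_distrib, Finset.sum_add_distrib]
  rw [Finset.sum_comm (f := fun k l => christoffel g l j k x * covVec g u l k x)]
  ring

lemma codiffTwo_extDer_flat (hg : IsMetricOn g V) (hx : x ∈ V)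
    (hu : ∀ x ∈ V, ∀ i, ContDiffAt ℝ 2 (fun y => u y i) x) (j : Fin n) :
    codiffTwo g (extDer (flat g u)) x j
      = -flat g (bochner g u) x j + ∑ k, covVec2 g u k j k x := by
  unfold codiffTwo
  simp only [hg.cov_extDer_flat hx hu, mul_sub, Finset.sum_sub_distrib]
  have h1 : ∀ k, ∑ i, (g x)⁻¹ k i * ∑ m, g x i m * covVec2 g u k j m x = covVec2 g u k j k x :=
    fun k => hg.inv_mulVec_flat (v := fun y m => covVec2 g u k j m y) hx k
  have h2 : ∑ k, ∑ i, (g x)⁻¹ k i * ∑ m, g x j m * covVec2 g u k i m x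
      = flat g (bochner g u) x j := by
    simp only [flat, bochner, Finset.mul_sum]
    rw [Finset.sum_congr rfl fun k _ => Finset.sum_comm, Finset.sum_comm]
    exact Finset.sum_congr rfl fun m _ => Finset.sum_congr rfl fun k _ =>
      Finset.sum_congr rfl fun i _ => by ring
  simp only [h1, h2]; ring

/-- The contracted Ricci identity. Already for each fixed `k`, second partials of `u` commute and
first-derivative terms cancel by symmetry of `Γ`, leaving a curvature component applied to `u`. -/
lemma commutator_covVec (hg : IsMetricOn g V) (hx : x ∈ V)
    (hu : ∀ x ∈ V, ∀ i, ContDiffAt ℝ 2 (fun y => u y i) x) (j : Fin n) :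
    ∑ k, covVec2 g u k j k x - ∑ k, covVec2 g u j k k x = ∑ l, ricci g l j x * u x l := by
  have hud : ∀ i, DifferentiableAt ℝ (fun y => u y i) x := fun i =>
    (hu x hx i).differentiableAt (by simp)
  have hΓ := hg.differentiableAt_christoffel hx
  have hpd : ∀ a b c, pd a (covVec g u b c) x = pd a (pd b (fun y => u y c)) x
      + ∑ l, (pd a (christoffel g c b l) x * u x l
        + christoffel g c b l x * pd a (fun y => u y l) x) := by
    intro a b c
    unfold covVec
    rw [pd_add ((contDiffAt_pd (m := 1) (hu x hx c) le_rfl).differentiableAt (by simp))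
      (DifferentiableAt.fun_sum fun l _ => (hΓ _ _ _).fun_mul (hud l)),
      pd_sum_mul (fun l _ => hΓ _ _ _) fun l _ => hud l]
  have hterm : ∀ k, covVec2 g u k j k x - covVec2 g u j k k x
      = ∑ l, (pd k (christoffel g k j l) x - pd j (christoffel g k k l) x
        + ∑ m, (christoffel g k k m x * christoffel g m j l x
          - christoffel g k j m x * christoffel g m k l x)) * u x l := by
    intro k
    simp only [covVec2, hpd, pd_comm (hu x hx k) k j, hg.christoffel_symm hx _ k j]
    simp only [covVec, mul_add, add_mul, sub_mul, Finset.sum_add_distrib, Finset.sum_sub_distrib,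
      Finset.mul_sum, Finset.sum_mul]
    rw [Finset.sum_comm (f := fun l m => christoffel g k k m x * christoffel g m j l x * u x l),
      Finset.sum_comm (f := fun l m => christoffel g k j m x * christoffel g m k l x * u x l)]
    simp only [mul_assoc]
    ring
  rw [← Finset.sum_sub_distrib]
  simp only [hterm, ricci, Finset.sum_mul]
  rw [Finset.sum_comm]

/-- The contracted symbol is `½ tr(g⁻¹ ∂ⱼg)`, since the other two terms of the Christoffel formula
are exchanged by swapping the summation indices. -/
lemma sum_christoffel (hg : IsMetricOn g V) (hx : x ∈ V) (j : Fin n) :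
    ∑ k, christoffel g k k j x
      = (1 / 2 : ℝ) * ∑ k, ∑ m, (g x)⁻¹ k m * pd j (fun y => g y k m) x := by
  unfold christoffel
  rw [← Finset.mul_sum]
  congr 1
  simp only [mul_add, mul_sub, Finset.sum_add_distrib, Finset.sum_sub_distrib]
  rw [Finset.sum_comm (f := fun k l => (g x)⁻¹ k l * pd l (fun y => g y k j) x)]
  have : ∑ k, ∑ l, (g x)⁻¹ k l * pd k (fun y => g y j l) x
      = ∑ l, ∑ k, (g x)⁻¹ k l * pd l (fun y => g y k j) x :=
    Finset.sum_congr rfl fun k _ => Finset.sum_congr rfl fun l _ => by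
      rw [hg.inv_symm hx k l, hg.pd_symm hx k j l]
  rw [this]; ring

lemma pd_inv (hg : IsMetricOn g V) (hx : x ∈ V) (l : Fin n) :
    Matrix.of (fun i j => pd l (fun y => (g y)⁻¹ i j) x)
      = -((g x)⁻¹ * Matrix.of (fun i j => pd l (fun y => g y i j) x) * (g x)⁻¹) := by
  have hgd : ∀ i j, DifferentiableAt ℝ (fun y => g y i j) x := fun i j =>
    (hg.smooth x hx i j).differentiableAt (by simp)
  have hid : ∀ i j, DifferentiableAt ℝ (fun y => (g y)⁻¹ i j) x := fun i j =>
    (hg.contDiffAt_inv hx i j).differentiableAt (by simp)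
  have h : Matrix.of (fun i j => pd l (fun y => (g y)⁻¹ i j) x) * g x
      + (g x)⁻¹ * Matrix.of (fun i j => pd l (fun y => g y i j) x) = 0 := by
    ext i j
    have h0 : pd l (fun y => ∑ k, (g y)⁻¹ i k * g y k j) x = 0 := by
      rw [pd_congr_on (g := fun _ => (1 : Matrix (Fin n) (Fin n) ℝ) i j) hg.isOpen hx, pd_const]
      intro y hy
      rw [← Matrix.nonsing_inv_mul (g y) (hg.isUnit_det hy), Matrix.mul_apply]
    have h1 := pd_sum_mul (i := l) (s := Finset.univ) (fun k _ => hid i k) fun k _ => hgd k j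
    rw [h0, Finset.sum_add_distrib] at h1
    simpa [Matrix.mul_apply] using h1.symm
  have h2 := congrArg (· * (g x)⁻¹) h
  simp only [add_mul, Matrix.mul_assoc, Matrix.mul_nonsing_inv _ (hg.isUnit_det hx),
    Matrix.mul_one, Matrix.zero_mul] at h2
  rw [eq_neg_of_add_eq_zero_left h2, Matrix.mul_assoc]

/-- The contracted symbol is the gradient of `½ log |det g|`, hence closed. Concretely, its
`l`-derivative is `½(-tr(g⁻¹ ∂ₗg g⁻¹ ∂ⱼg) + tr(g⁻¹ ∂ₗ∂ⱼg))`, symmetric in `j, l` by cyclicity of the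
trace and equality of mixed partials. -/
lemma pd_sum_christoffel_symm (hg : IsMetricOn g V) (hx : x ∈ V) (j l : Fin n) :
    ∑ k, pd l (christoffel g k k j) x = ∑ k, pd j (christoffel g k k l) x := by
  have hid : ∀ i j, DifferentiableAt ℝ (fun y => (g y)⁻¹ i j) x := fun i j =>
    (hg.contDiffAt_inv hx i j).differentiableAt (by simp)
  have hpd : ∀ j k m, DifferentiableAt ℝ (pd j (fun y => g y k m)) x := fun j k m =>
    (contDiffAt_pd (m := 1) ((hg.smooth x hx k m).of_le (m := 2) ENat.LEInfty.out)
      le_rfl).differentiableAt (by simp)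
  have key : ∀ j l, ∑ k, pd l (christoffel g k k j) x
      = (1 / 2 : ℝ) * (-Matrix.trace ((g x)⁻¹ * Matrix.of (fun i j => pd l (fun y => g y i j) x) *
          ((g x)⁻¹ * Matrix.of (fun a b => pd j (fun y => g y a b) x)))
        + ∑ k, ∑ m, (g x)⁻¹ k m * pd l (pd j (fun y => g y k m)) x) := by
    intro j l
    rw [← pd_sum fun k _ => hg.differentiableAt_christoffel hx k k j,
      pd_congr_on hg.isOpen hx fun y hy => hg.sum_christoffel hy j,
      pd_mul (differentiableAt_const _) (DifferentiableAt.fun_sum fun k _ =>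
        DifferentiableAt.fun_sum fun m _ => (hid k m).fun_mul (hpd j k m)), pd_const, zero_mul,
      zero_add, pd_sum fun k _ => DifferentiableAt.fun_sum fun m _ => (hid k m).fun_mul (hpd j k m),
      Finset.sum_congr rfl fun k _ => pd_sum_mul (fun m _ => hid k m) fun m _ => hpd j k m]
    simp only [Finset.sum_add_distrib]
    congr 2
    rw [← Matrix.mul_assoc, ← Matrix.trace_neg, ← Matrix.neg_mul, ← hg.pd_inv hx l]
    simp only [Matrix.trace, Matrix.diag, Matrix.mul_apply, Matrix.of_apply]
    exact Finset.sum_congr rfl fun k _ => Finset.sum_congr rfl fun m _ => by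
      rw [hg.pd_symm hx j k m]
  rw [key, key, Matrix.trace_mul_comm]
  congr 2
  exact Finset.sum_congr rfl fun k _ => Finset.sum_congr rfl fun m _ => by
    rw [pd_comm ((hg.smooth x hx k m).of_le ENat.LEInfty.out) l j]

/-- The only term not visibly symmetric is `∂ₗ Γᵏ_{kj}`. Symmetry is needed because the commutator
produces the Ricci indices in the opposite order to `ricciVec`. -/
lemma ricci_symm (hg : IsMetricOn g V) (hx : x ∈ V) (j l : Fin n) :
    ricci g j l x = ricci g l j x := by
  have h1 : ∀ k, pd k (christoffel g k l j) x = pd k (christoffel g k j l) x := fun k =>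
    pd_congr_on hg.isOpen hx fun y hy => hg.christoffel_symm hy k l j
  unfold ricci
  simp only [Finset.sum_add_distrib, Finset.sum_sub_distrib, h1,
    hg.pd_sum_christoffel_symm hx j l, hg.christoffel_symm hx _ l j]
  rw [Finset.sum_comm (f := fun k m => christoffel g k l m x * christoffel g m k j x)]
  congr 2
  exact Finset.sum_congr rfl fun k _ => Finset.sum_congr rfl fun m _ => by
    rw [hg.christoffel_symm hx m l k, hg.christoffel_symm hx k j m,
      hg.christoffel_symm hx k m j, mul_comm]

/-- `dδ` contributes `-∇ⱼ∇ₖuᵏ` and `δd` contributes `∇ₖ∇ⱼuᵏ` besides the rough Laplacian; their sum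
is the commutator, that is, Ricci. -/
theorem hodge_eq_bochner_sub_ricci (hg : IsMetricOn g V) (hx : x ∈ V)
    (hu : ∀ x ∈ V, ∀ i, ContDiffAt ℝ 2 (fun y => u y i) x) (i : Fin n) :
    hodge g u x i = bochner g u x i - ricciVec g u x i := by
  have h : ∀ j, pd j (codiffOne g (flat g u)) x + codiffTwo g (extDer (flat g u)) x j
      = -flat g (bochner g u) x j + ∑ k, ricci g j k x * u x k := by
    intro j
    rw [hg.pd_codiffOne_flat hx hu, hg.codiffTwo_extDer_flat hx hu]
    have := hg.commutator_covVec hx hu j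
    simp only [hg.ricci_symm hx j]
    linarith
  unfold hodge
  simp only [h, mul_add, mul_neg, Finset.sum_add_distrib, Finset.sum_neg_distrib,
    hg.inv_mulVec_flat hx, ricciVec, Finset.mul_sum, mul_assoc]
  ring

end IsMetricOn

end Weitzenboeck

end ThinShell
namespace ThinShell

/-! ### Expansions and traces in a frame of tangent vectors and a unit normal. -/

section Frame

variable {n : ℕ} {e : Fin n → Amb n} {ν : Amb n}

lemma span_frame_eq_top (he : LinearIndependent ℝ e) (hν : inner ℝ ν ν = 1)
    (hort : ∀ i, inner ℝ ν (e i) = 0) :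
    Submodule.span ℝ (Set.range (Fin.cons ν e : Fin (n + 1) → Amb n)) = ⊤ := by
  refine LinearIndependent.span_eq_top_of_card_eq_finrank' ?_ (by simp)
  refine linearIndependent_finCons.2 ⟨he, fun hmem => ?_⟩
  have : ∀ w ∈ Submodule.span ℝ (Set.range e), inner ℝ ν w = 0 := by
    intro w hw
    induction hw using Submodule.span_induction with
    | mem w hw => obtain ⟨i, rfl⟩ := hw; exact hort i
    | zero => simp
    | add a b _ _ ha hb => rw [inner_add_right, ha, hb, add_zero]
    | smul c a _ ha => rw [inner_smul_right, ha, mul_zero]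
  rw [this ν hmem] at hν
  exact zero_ne_one hν

/-- Expansion of a vector in a frame of tangent vectors and a unit normal. -/
lemma frame_expand (he : LinearIndependent ℝ e) (hν : inner ℝ ν ν = 1)
    (hort : ∀ i, inner ℝ ν (e i) = 0) (v : Amb n) :
    v = ∑ j, (∑ i, (Matrix.gram ℝ e)⁻¹ i j * inner ℝ v (e i)) • e j + inner ℝ v ν • ν := by
  -- The remainder `d` is orthogonal to every frame vector; the frame spans, so `d` is orthogonal to
  -- itself.
  set d := v - (∑ j, (∑ i, (Matrix.gram ℝ e)⁻¹ i j * inner ℝ v (e i)) • e j + inner ℝ v ν • ν)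
    with hd
  have hG : (Matrix.gram ℝ e)⁻¹ * Matrix.gram ℝ e = 1 :=
    Matrix.nonsing_inv_mul _ (Matrix.det_gram_ne_zero_iff_linearIndependent.2 he).isUnit
  have hort' : ∀ i, inner ℝ (e i) ν = 0 := fun i => by rw [real_inner_comm]; exact hort i
  have h1 : ∀ k, inner ℝ d (e k) = 0 := by
    intro k
    have : ∀ i, ∑ j, (Matrix.gram ℝ e)⁻¹ i j * inner ℝ (e j) (e k) = if i = k then 1 else 0 := by
      intro i
      have := congrFun (congrFun hG i) k
      rwa [Matrix.mul_apply, Matrix.one_apply] at this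
    rw [hd, inner_sub_left, inner_add_left, sum_inner, inner_smul_left, hort]
    simp only [inner_smul_left, RCLike.conj_to_real, Finset.sum_mul, mul_zero, add_zero]
    rw [Finset.sum_comm]
    have h2 : ∀ i, ∑ j, (Matrix.gram ℝ e)⁻¹ i j * inner ℝ v (e i) * inner ℝ (e j) (e k)
        = (if i = k then 1 else 0) * inner ℝ v (e i) := by
      intro i
      rw [← this, Finset.sum_mul]
      exact Finset.sum_congr rfl fun j _ => by ring
    simp [h2]
  have h2 : inner ℝ d ν = 0 := by
    rw [hd, inner_sub_left, inner_add_left, sum_inner, inner_smul_left, hν]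
    simp [inner_smul_left, hort']
  have h3 : ∀ w ∈ Submodule.span ℝ (Set.range (Fin.cons ν e : Fin (n + 1) → Amb n)),
      inner ℝ d w = 0 := by
    intro w hw
    induction hw using Submodule.span_induction with
    | mem w hw =>
      obtain ⟨i, rfl⟩ := hw
      refine Fin.cases ?_ (fun i => ?_) i
      · simpa using h2
      · simpa using h1 i
    | zero => simp
    | add a b _ _ ha hb => rw [inner_add_right, ha, hb, add_zero]
    | smul c a _ ha => rw [inner_smul_right, ha, mul_zero]
  have h4 : d = 0 := inner_self_eq_zero.1
    (h3 d (by rw [span_frame_eq_top he hν hort]; exact Submodule.mem_top))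
  exact sub_eq_zero.1 h4

/-- The trace of a bilinear form in a frame of tangent vectors and a unit normal. -/
lemma frame_trace (he : LinearIndependent ℝ e) (hν : inner ℝ ν ν = 1)
    (hort : ∀ i, inner ℝ ν (e i) = 0) {ι : Type*} [Fintype ι] (b : OrthonormalBasis ι ℝ (Amb n))
    (B : Amb n →ₗ[ℝ] Amb n →ₗ[ℝ] ℝ) :
    ∑ a, B (b a) (b a) = ∑ i, ∑ j, (Matrix.gram ℝ e)⁻¹ i j * B (e i) (e j) + B ν ν := by
  have hexp : ∀ w z, ∑ a, inner ℝ (b a) w * B (b a) z = B w z := by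
    intro w z
    conv_rhs => rw [← b.sum_repr' w]
    simp
  -- Only the second slot is expanded in the frame; summing over the orthonormal basis with `hexp`
  -- then converts the first slot.
  have h1 : ∀ a, B (b a) (b a) = ∑ j, ∑ i, (Matrix.gram ℝ e)⁻¹ i j * (inner ℝ (b a) (e i) *
      B (b a) (e j)) + inner ℝ (b a) ν * B (b a) ν := by
    intro a
    have h2 := congrArg (B (b a)) (frame_expand he hν hort (b a))
    simp only [map_add, map_sum, map_smul, smul_eq_mul, Finset.sum_mul] at h2
    rw [h2]
    simp only [mul_assoc]
  simp only [h1, Finset.sum_add_distrib, hexp]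
  congr 1
  rw [Finset.sum_comm, Finset.sum_comm (f := fun i j => (Matrix.gram ℝ e)⁻¹ i j * B (e i) (e j))]
  refine Finset.sum_congr rfl fun j _ => ?_
  rw [Finset.sum_comm]
  exact Finset.sum_congr rfl fun i _ => by rw [← Finset.mul_sum, hexp]

end Frame

/-! ### Gauss and Weingarten equations of a patch, and Fermi coordinates. -/

section Patch

variable {n : ℕ} {φ : Coord n → Amb n} {N : Amb n → Amb n} {V : Set (Coord n)} {x : Coord n}

/-- A smooth immersed coordinate patch `φ` on an open set `V` with smooth unit normal `N ∘ φ`. -/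
structure IsNormalPatch (φ : Coord n → Amb n) (N : Amb n → Amb n) (V : Set (Coord n)) : Prop where
  isOpen : IsOpen V
  smooth : ∀ x ∈ V, ContDiffAt ℝ ∞ φ x
  smooth_normal : ∀ x ∈ V, ContDiffAt ℝ ∞ (fun y => N (φ y)) x
  linearIndependent : ∀ x ∈ V, LinearIndependent ℝ fun i => pd i φ x
  unit : ∀ x ∈ V, inner ℝ (N (φ x)) (N (φ x)) = 1
  normal : ∀ x ∈ V, ∀ i, inner ℝ (N (φ x)) (pd i φ x) = 0

lemma IsLocalParam.mem {M : Set (Amb n)} (hφ : IsLocalParam M φ V) (hx : x ∈ V) : φ x ∈ M := by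
  obtain ⟨W, -, hW⟩ := hφ.relOpen V subset_rfl hφ.isOpen
  exact (hW ▸ Set.mem_image_of_mem φ hx : φ x ∈ M ∩ W).1

lemma IsLocalParam.isNormalPatch {M : Set (Amb n)} (hφ : IsLocalParam M φ V)
    (hN : IsUnitNormal M N) : IsNormalPatch φ N V where
  isOpen := hφ.isOpen
  smooth x hx := hφ.contDiffOn.contDiffAt (hφ.isOpen.mem_nhds hx)
  smooth_normal x hx := (hN.smooth φ V hφ).contDiffAt (hφ.isOpen.mem_nhds hx)
  linearIndependent x hx := by
    have h := (Pi.basisFun ℝ (Fin n)).linearIndependent.map' (fderiv ℝ φ x).toLinearMap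
      (LinearMap.ker_eq_bot.2 (hφ.immersion x hx))
    have he : (fun i => pd i φ x) = (fderiv ℝ φ x).toLinearMap ∘ Pi.basisFun ℝ (Fin n) := by
      funext i; simp [pd]
    rw [he]; exact h
  unit x hx := by
    rw [real_inner_self_eq_norm_sq, hN.norm_eq_one _ (hφ.mem hx), one_pow]
  normal x hx i := hN.normal φ V hφ x hx _

namespace IsNormalPatch

lemma contDiffAt_frame (h : IsNormalPatch φ N V) (hx : x ∈ V) (i : Fin n) :
    ContDiffAt ℝ ∞ (pd i φ) x := contDiffAt_pd (h.smooth x hx) le_rfl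

lemma contDiffAt_pd_normal (h : IsNormalPatch φ N V) (hx : x ∈ V) (i : Fin n) :
    ContDiffAt ℝ ∞ (pd i fun y => N (φ y)) x := contDiffAt_pd (h.smooth_normal x hx) le_rfl

lemma differentiableAt (h : IsNormalPatch φ N V) (hx : x ∈ V) : DifferentiableAt ℝ φ x :=
  (h.smooth x hx).differentiableAt (by simp)

lemma differentiableAt_normal (h : IsNormalPatch φ N V) (hx : x ∈ V) :
    DifferentiableAt ℝ (fun y => N (φ y)) x :=
  (h.smooth_normal x hx).differentiableAt (by simp)

lemma differentiableAt_frame (h : IsNormalPatch φ N V) (hx : x ∈ V) (i : Fin n) :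
    DifferentiableAt ℝ (pd i φ) x :=
  (h.contDiffAt_frame hx i).differentiableAt (by simp)

lemma pd_frame_comm (h : IsNormalPatch φ N V) (hx : x ∈ V) (i j : Fin n) :
    pd i (pd j φ) x = pd j (pd i φ) x :=
  pd_comm ((h.smooth x hx).of_le ENat.LEInfty.out) i j

lemma isMetricOn (h : IsNormalPatch φ N V) : IsMetricOn (inducedMetric φ) V where
  isOpen := h.isOpen
  smooth _ hx i j := (h.contDiffAt_frame hx i).inner ℝ (h.contDiffAt_frame hx j)
  symm _ _ i j := real_inner_comm (pd j φ _) (pd i φ _)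
  det_ne_zero _ hx := Matrix.det_gram_ne_zero_iff_linearIndependent.2 (h.linearIndependent _ hx)

lemma expand (h : IsNormalPatch φ N V) (hx : x ∈ V) (v : Amb n) :
    v = ∑ j, (∑ i, (inducedMetric φ x)⁻¹ j i * inner ℝ v (pd i φ x)) • pd j φ x
      + inner ℝ v (N (φ x)) • N (φ x) := by
  have h1 := frame_expand (h.linearIndependent x hx) (h.unit x hx) (h.normal x hx) v
  have h2 : ∀ i j, (Matrix.gram ℝ fun i => pd i φ x)⁻¹ i j = (inducedMetric φ x)⁻¹ j i :=
    fun i j => h.isMetricOn.inv_symm hx i j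
  simp only [h2] at h1
  exact h1

lemma inner_pd_normal_normal (h : IsNormalPatch φ N V) (hx : x ∈ V) (i : Fin n) :
    inner ℝ (pd i (fun y => N (φ y)) x) (N (φ x)) = 0 := by
  have hd := h.differentiableAt_normal hx
  have h1 := pd_inner (i := i) hd hd
  rw [pd_congr_on h.isOpen hx h.unit, pd_const] at h1
  have h2 := real_inner_comm (N (φ x)) (pd i (fun y => N (φ y)) x)
  linarith

lemma inner_pd_normal_frame (h : IsNormalPatch φ N V) (hx : x ∈ V) (i j : Fin n) :
    inner ℝ (pd i (fun y => N (φ y)) x) (pd j φ x) = -inner ℝ (N (φ x)) (pd i (pd j φ) x) := by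
  have h1 := pd_inner (i := i) (h.differentiableAt_normal hx) (h.differentiableAt_frame hx j)
  rw [pd_congr_on h.isOpen hx fun y hy => h.normal y hy j, pd_const] at h1
  linarith

/-- Self-adjointness of the shape operator: differentiating `⟨N, ∂ⱼφ⟩ = 0` moves the derivative onto
`∂ᵢ∂ⱼφ`, which is symmetric. -/
lemma inner_pd_normal_symm (h : IsNormalPatch φ N V) (hx : x ∈ V) (i j : Fin n) :
    inner ℝ (pd i (fun y => N (φ y)) x) (pd j φ x)
      = inner ℝ (pd j (fun y => N (φ y)) x) (pd i φ x) := by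
  rw [h.inner_pd_normal_frame hx, h.inner_pd_normal_frame hx, h.pd_frame_comm hx]

/-- The Weingarten equation. -/
lemma pd_normal (h : IsNormalPatch φ N V) (hx : x ∈ V) (j : Fin n) :
    pd j (fun y => N (φ y)) x = -∑ l, shape φ N x l j • pd l φ x := by
  conv_lhs => rw [h.expand hx (pd j (fun y => N (φ y)) x), h.inner_pd_normal_normal hx]
  rw [zero_smul, add_zero, ← Finset.sum_neg_distrib]
  refine Finset.sum_congr rfl fun l _ => ?_
  simp [shape, inner_neg_left]

lemma christoffel_eq (h : IsNormalPatch φ N V) (hx : x ∈ V) (k i j : Fin n) :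
    christoffel (inducedMetric φ) k i j x
      = ∑ l, (inducedMetric φ x)⁻¹ k l * inner ℝ (pd i (pd j φ) x) (pd l φ x) := by
  have hpd : ∀ a b c, pd a (fun y => inducedMetric φ y b c) x
      = inner ℝ (pd a (pd b φ) x) (pd c φ x) + inner ℝ (pd b φ x) (pd a (pd c φ) x) := fun a b c =>
    pd_inner (h.differentiableAt_frame hx b) (h.differentiableAt_frame hx c)
  unfold christoffel
  rw [Finset.mul_sum]
  refine Finset.sum_congr rfl fun l _ => ?_
  rw [hpd, hpd, hpd, h.pd_frame_comm hx l i, h.pd_frame_comm hx l j, h.pd_frame_comm hx j i,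
    real_inner_comm (pd j φ x) (pd i (pd l φ) x)]
  ring

/-- The Gauss formula. -/
lemma pd_frame (h : IsNormalPatch φ N V) (hx : x ∈ V) (i j : Fin n) :
    pd i (pd j φ) x = ∑ l, christoffel (inducedMetric φ) l i j x • pd l φ x
      + inner ℝ (pd i (pd j φ) x) (N (φ x)) • N (φ x) := by
  simp only [h.christoffel_eq hx]
  exact h.expand hx _

lemma trace_eq (h : IsNormalPatch φ N V) (hx : x ∈ V) {ι : Type*} [Fintype ι]
    (b : OrthonormalBasis ι ℝ (Amb n)) (B : Amb n →ₗ[ℝ] Amb n →ₗ[ℝ] ℝ) :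
    ∑ a, B (b a) (b a) = ∑ i, ∑ j, (inducedMetric φ x)⁻¹ i j * B (pd i φ x) (pd j φ x)
      + B (N (φ x)) (N (φ x)) :=
  frame_trace (h.linearIndependent x hx) (h.unit x hx) (h.normal x hx) b B

lemma fermiVec_eq (h : IsNormalPatch φ N V) (hx : x ∈ V) (r : ℝ) (i : Fin n) :
    fermiVec φ N r x i = pd i φ x + r • pd i (fun y => N (φ y)) x := by
  have hs : pd i (fun y => r • N (φ y)) x = r • pd i (fun y => N (φ y)) x := by
    simp [pd, fderiv_fun_const_smul (h.differentiableAt_normal hx)]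
  unfold fermiVec fermi
  rw [pd_add (h.differentiableAt hx) ((h.differentiableAt_normal hx).fun_const_smul r), hs]

end IsNormalPatch

lemma fermi_zero : fermi φ N 0 = φ := by funext y; simp [fermi]

lemma fermiVec_zero (i : Fin n) : fermiVec φ N 0 x i = pd i φ x := by
  simp [fermiVec, fermi_zero]

lemma fermiMetric_zero : fermiMetric φ N 0 x = inducedMetric φ x := by
  simp [fermiMetric, inducedMetric, fermiVec_zero]

lemma lowerComp_zero (X : Amb n → Amb n) (i : Fin n) :
    lowerComp φ N X 0 x i = inner ℝ (X (φ x)) (pd i φ x) := by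
  simp [lowerComp, fermi_zero, fermiVec_zero]

/-- Identifies `u♭` with the pullback of `U♭`, so that intrinsic operators on `u` can be computed
from ambient derivatives of `U`. -/
lemma IsNormalPatch.flat_upperComp_zero (h : IsNormalPatch φ N V) (hx : x ∈ V)
    (X : Amb n → Amb n) (i : Fin n) :
    flat (inducedMetric φ) (upperComp φ N X 0) x i = inner ℝ (X (φ x)) (pd i φ x) := by
  have h1 : (inducedMetric φ x).mulVec
      ((inducedMetric φ x)⁻¹.mulVec (lowerComp φ N X 0 x)) = lowerComp φ N X 0 x := by
    rw [Matrix.mulVec_mulVec, Matrix.mul_nonsing_inv _ (h.isMetricOn.isUnit_det hx),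
      Matrix.one_mulVec]
  have h2 : upperComp φ N X 0 x = (inducedMetric φ x)⁻¹.mulVec (lowerComp φ N X 0 x) := by
    rw [← fermiMetric_zero (N := N)]; rfl
  rw [← lowerComp_zero (N := N), ← congrFun h1 i, ← h2]
  rfl

end Patch

end ThinShell
namespace ThinShell

lemma pd_clm_apply {n : ℕ} {E F : Type*} [NormedAddCommGroup E] [NormedSpace ℝ E]
    [NormedAddCommGroup F] [NormedSpace ℝ F] {P : Coord n → E →L[ℝ] F} {v : Coord n → E}
    {x : Coord n} {k : Fin n} (hP : DifferentiableAt ℝ P x) (hv : DifferentiableAt ℝ v x) :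
    pd k (fun y => P y (v y)) x = pd k P x (v x) + P x (pd k v x) := by
  unfold pd
  rw [fderiv_clm_apply hP hv]
  simp [add_comm]

/-! ### Consequences of the Hodge condition along one normal line. -/

section NormalLine

variable {E : Type*} [NormedAddCommGroup E] [InnerProductSpace ℝ E] {U : E → E} {p ν w w' : E}

/-- For `p = φ x`, `ν = N (φ x)`, `w = ∂ᵢφ` and `w' = ∂ᵢ(N ∘ φ)` the function is the covariant
component `Uᵢ(r, x)`. -/
lemma eventually_hasDerivAt_normalLine (hU : ContDiffAt ℝ 2 U p) :
    ∀ᶠ r in 𝓝 (0 : ℝ), HasDerivAt (fun s : ℝ => (inner ℝ (U (p + s • ν)) (w + s • w') : ℝ))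
      (inner ℝ (fderiv ℝ U (p + r • ν) ν) (w + r • w') + inner ℝ (U (p + r • ν)) w') r := by
  have hq : ContinuousAt (fun r : ℝ => p + r • ν) 0 := by fun_prop
  have h1 : ∀ᶠ z in 𝓝 (p + (0 : ℝ) • ν), DifferentiableAt ℝ U z := by
    rw [zero_smul, add_zero]
    exact (hU.eventually (by simp)).mono fun z hz => hz.differentiableAt (by simp)
  filter_upwards [hq.eventually h1] with r hr
  have hline : ∀ a b : E, HasDerivAt (fun s : ℝ => a + s • b) b r := fun a b => by
    simpa using ((hasDerivAt_id r).smul_const b).const_add a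
  have h2 := (hr.hasFDerivAt.comp_hasDerivAt r (hline p ν)).inner ℝ (hline w w')
  exact h2.congr_deriv (add_comm _ _)

lemma contDiffAt_normalLine (hU : ContDiffAt ℝ 2 U p) :
    ContDiffAt ℝ 2 (fun s : ℝ => (inner ℝ (U (p + s • ν)) (w + s • w') : ℝ)) 0 := by
  have hU' : ContDiffAt ℝ 2 U (p + (0 : ℝ) • ν) := by simpa using hU
  refine ContDiffAt.inner ℝ (hU'.comp (0 : ℝ) (f := fun s : ℝ => p + s • ν) ?_) ?_ <;> fun_prop

lemma normalLine_first_order (hU : ContDiffAt ℝ 2 U p)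
    (h : ∀ᶠ r in 𝓝 (0 : ℝ),
      deriv (fun s : ℝ => (inner ℝ (U (p + s • ν)) (w + s • w') : ℝ)) r = 0) :
    inner ℝ (fderiv ℝ U p ν) w + inner ℝ (U p) w' = 0 := by
  have h1 := (eventually_hasDerivAt_normalLine (ν := ν) (w := w) (w' := w') hU).self_of_nhds.deriv
  rw [h.self_of_nhds] at h1
  simpa using h1.symm

/-- The first derivative vanishes on a neighbourhood of `0`, so it can be differentiated again. The
factor `w + r • w'` is affine, so only `D²U` and two equal cross terms survive. -/
lemma normalLine_second_order (hU : ContDiffAt ℝ 2 U p)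
    (h : ∀ᶠ r in 𝓝 (0 : ℝ),
      deriv (fun s : ℝ => (inner ℝ (U (p + s • ν)) (w + s • w') : ℝ)) r = 0) :
    inner ℝ (fderiv ℝ (fderiv ℝ U) p ν ν) w + 2 * inner ℝ (fderiv ℝ U p ν) w' = 0 := by
  have h0 : (fun r : ℝ => inner ℝ (fderiv ℝ U (p + r • ν) ν) (w + r • w')
      + inner ℝ (U (p + r • ν)) w') =ᶠ[𝓝 0] fun _ => (0 : ℝ) := by
    filter_upwards [h, eventually_hasDerivAt_normalLine (ν := ν) (w := w) (w' := w') hU]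
      with r h1 h2
    rw [← h2.deriv, h1]
  have hline : ∀ a b : E, HasDerivAt (fun s : ℝ => a + s • b) b 0 := fun a b => by
    simpa using ((hasDerivAt_id (0 : ℝ)).smul_const b).const_add a
  have hUd : HasFDerivAt U (fderiv ℝ U p) (p + (0 : ℝ) • ν) := by
    simpa using (hU.differentiableAt (by simp)).hasFDerivAt
  have hUdd : HasFDerivAt (fderiv ℝ U) (fderiv ℝ (fderiv ℝ U) p) (p + (0 : ℝ) • ν) := by
    simpa using ((hU.fderiv_right (m := 1) le_rfl).differentiableAt one_ne_zero).hasFDerivAt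
  have h1 : HasDerivAt (fun r : ℝ => fderiv ℝ U (p + r • ν) ν) (fderiv ℝ (fderiv ℝ U) p ν ν) 0 := by
    have h2 : HasDerivAt (fun r : ℝ => fderiv ℝ U (p + r • ν)) (fderiv ℝ (fderiv ℝ U) p ν) 0 :=
      hUdd.comp_hasDerivAt (0 : ℝ) (hline p ν)
    simpa using h2.clm_apply (hasDerivAt_const (0 : ℝ) ν)
  have h2 : HasDerivAt (fun r : ℝ => U (p + r • ν)) (fderiv ℝ U p ν) 0 :=
    hUd.comp_hasDerivAt (0 : ℝ) (hline p ν)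
  have h3 := (h1.inner ℝ (hline w w')).fun_add (h2.inner ℝ (hasDerivAt_const (0 : ℝ) w'))
  have h4 := h3.deriv
  rw [Filter.EventuallyEq.deriv_eq (f := fun _ : ℝ => (0 : ℝ)) h0, deriv_const] at h4
  simp only [zero_smul, add_zero, inner_zero_right, zero_add] at h4
  linarith

lemma normalLine_const (hU : ContDiffAt ℝ 2 U p)
    (h : ∀ᶠ r in 𝓝 (0 : ℝ),
      deriv (fun s : ℝ => (inner ℝ (U (p + s • ν)) (w + s • w') : ℝ)) r = 0) :
    ∀ᶠ r in 𝓝 (0 : ℝ),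
      (inner ℝ (U (p + r • ν)) (w + r • w') : ℝ) = inner ℝ (U p) w := by
  obtain ⟨ε, hε, hball⟩ := Metric.eventually_nhds_iff_ball.1
    (h.and (eventually_hasDerivAt_normalLine (ν := ν) (w := w) (w' := w') hU))
  filter_upwards [Metric.ball_mem_nhds 0 hε] with r hr
  have := Metric.isOpen_ball.is_const_of_deriv_eq_zero
    (convex_ball (0 : ℝ) ε).isPreconnected
    (f := fun s : ℝ => (inner ℝ (U (p + s • ν)) (w + s • w') : ℝ))
    (fun s hs => (hball s hs).2.differentiableAt.differentiableWithinAt)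
    (fun s hs => (hball s hs).1) hr (Metric.mem_ball_self hε)
  simpa using this

end NormalLine

/-! ### Hodge operators on the patch in terms of ambient derivatives. -/

lemma codiffOne_congr {n : ℕ} {g : Coord n → Matrix (Fin n) (Fin n) ℝ} {V : Set (Coord n)}
    {x : Coord n} {w w' : Coord n → Fin n → ℝ} (hV : IsOpen V) (hx : x ∈ V)
    (h : ∀ y ∈ V, ∀ i, w y i = w' y i) : codiffOne g w x = codiffOne g w' x := by
  unfold codiffOne
  have : ∀ i j, pd i (fun y => w y j) x = pd i (fun y => w' y j) x := fun i j =>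
    pd_congr_on hV hx fun y hy => h y hy j
  simp only [this, h x hx]

lemma extDer_congr {n : ℕ} {V : Set (Coord n)}
    {x : Coord n} {w w' : Coord n → Fin n → ℝ} (hV : IsOpen V) (hx : x ∈ V)
    (h : ∀ y ∈ V, ∀ i, w y i = w' y i) (i j : Fin n) : extDer w x i j = extDer w' x i j := by
  unfold extDer
  rw [pd_congr_on hV hx fun y hy => h y hy j, pd_congr_on hV hx fun y hy => h y hy i]

lemma codiffTwo_congr {n : ℕ} {g : Coord n → Matrix (Fin n) (Fin n) ℝ} {V : Set (Coord n)}
    {x : Coord n} {b b' : Coord n → Fin n → Fin n → ℝ} (hV : IsOpen V) (hx : x ∈ V)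
    (h : ∀ y ∈ V, ∀ i j, b y i j = b' y i j) (j : Fin n) :
    codiffTwo g b x j = codiffTwo g b' x j := by
  unfold codiffTwo
  have : ∀ k i j, pd k (fun y => b y i j) x = pd k (fun y => b' y i j) x := fun k i j =>
    pd_congr_on hV hx fun y hy => h y hy i j
  simp only [this, h x hx]

lemma ambientBochner_eq_sum {n : ℕ} (U : Amb n → Amb n) {ι : Type*} [Fintype ι]
    (b : OrthonormalBasis ι ℝ (Amb n)) :
    ambientBochner U = fun p => ∑ a, fderiv ℝ (fderiv ℝ U) p (b a) (b a) := by
  unfold ambientBochner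
  rw [InnerProductSpace.laplacian_eq_iteratedFDeriv_orthonormalBasis U b]
  funext p
  simp [iteratedFDeriv_two_apply]

lemma continuousAt_ambientBochner {n : ℕ} {U : Amb n → Amb n} {p : Amb n}
    (hU : ContDiffAt ℝ 2 U p) : ContinuousAt (ambientBochner U) p := by
  have h : ContinuousAt (fderiv ℝ (fderiv ℝ U)) p :=
    ((hU.fderiv_right (m := 1) le_rfl).fderiv_right (m := 0) (by simp)).continuousAt
  rw [ambientBochner_eq_sum U (EuclideanSpace.basisFun _ ℝ)]
  exact tendsto_finsetSum _ fun a _ =>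
    (h.clm_apply continuousAt_const).clm_apply continuousAt_const

/-- The pullback to a coordinate patch of the one-form dual to an ambient field. -/
noncomputable def pullback {n : ℕ} (φ : Coord n → Amb n) (U : Amb n → Amb n)
    (y : Coord n) (i : Fin n) : ℝ :=
  inner ℝ (U (φ y)) (pd i φ y)

namespace IsNormalPatch

variable {n : ℕ} {φ : Coord n → Amb n} {N : Amb n → Amb n} {V : Set (Coord n)} {x : Coord n}
  {U : Amb n → Amb n}

lemma pd_pullback (h : IsNormalPatch φ N V) (hx : x ∈ V) (hU : ContDiffAt ℝ 2 U (φ x))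
    (i j : Fin n) :
    pd i (fun y => pullback φ U y j) x
      = inner ℝ (fderiv ℝ U (φ x) (pd i φ x)) (pd j φ x)
        + inner ℝ (U (φ x)) (pd i (pd j φ) x) := by
  have hd := hU.differentiableAt (by simp)
  have hUφ : DifferentiableAt ℝ (fun y => U (φ y)) x := hd.comp x (h.differentiableAt hx)
  unfold pullback
  rw [pd_inner hUφ (h.differentiableAt_frame hx j), pd_comp hd (h.differentiableAt hx)]

lemma extDer_pullback (h : IsNormalPatch φ N V) (hx : x ∈ V) (hU : ContDiffAt ℝ 2 U (φ x))
    (i j : Fin n) :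
    extDer (pullback φ U) x i j = inner ℝ (fderiv ℝ U (φ x) (pd i φ x)) (pd j φ x)
      - inner ℝ (fderiv ℝ U (φ x) (pd j φ x)) (pd i φ x) := by
  unfold extDer
  rw [h.pd_pullback hx hU, h.pd_pullback hx hU, h.pd_frame_comm hx i j]
  ring

/-- Differentiating `⟨DU(∂ᵢφ), ∂ⱼφ⟩` along the patch. -/
lemma pd_inner_fderiv_frame (h : IsNormalPatch φ N V) (hx : x ∈ V)
    (hU : ContDiffAt ℝ 2 U (φ x)) (k i j : Fin n) :
    DifferentiableAt ℝ (fun y => (inner ℝ (fderiv ℝ U (φ y) (pd i φ y)) (pd j φ y) : ℝ)) x ∧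
    pd k (fun y => (inner ℝ (fderiv ℝ U (φ y) (pd i φ y)) (pd j φ y) : ℝ)) x
      = inner ℝ (fderiv ℝ (fderiv ℝ U) (φ x) (pd k φ x) (pd i φ x)) (pd j φ x)
        + inner ℝ (fderiv ℝ U (φ x) (pd k (pd i φ) x)) (pd j φ x)
        + inner ℝ (fderiv ℝ U (φ x) (pd i φ x)) (pd k (pd j φ) x) := by
  have hd := (hU.fderiv_right (m := 1) le_rfl).differentiableAt one_ne_zero
  have hP : DifferentiableAt ℝ (fun y => fderiv ℝ U (φ y)) x := hd.comp x (h.differentiableAt hx)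
  have hPe := hP.clm_apply (h.differentiableAt_frame hx i)
  refine ⟨hPe.inner ℝ (h.differentiableAt_frame hx j), ?_⟩
  rw [pd_inner hPe (h.differentiableAt_frame hx j), pd_clm_apply hP (h.differentiableAt_frame hx i),
    pd_comp hd (h.differentiableAt hx), inner_add_left]

/-- In the Gauss formula the normal part of `∂ₖ∂ᵢφ` pairs with the antisymmetric part of `DU` to
give the second fundamental form times the tangential vorticity, which is zero; only Christoffel
terms remain. -/
lemma vorticity_gauss (h : IsNormalPatch φ N V) (hx : x ∈ V)
    (hvort : ∀ i, inner ℝ (fderiv ℝ U (φ x) (N (φ x))) (pd i φ x)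
      = inner ℝ (fderiv ℝ U (φ x) (pd i φ x)) (N (φ x))) (k i j : Fin n) :
    inner ℝ (fderiv ℝ U (φ x) (pd k (pd i φ) x)) (pd j φ x)
        - inner ℝ (fderiv ℝ U (φ x) (pd j φ x)) (pd k (pd i φ) x)
      = ∑ l, christoffel (inducedMetric φ) l k i x *
        (inner ℝ (fderiv ℝ U (φ x) (pd l φ x)) (pd j φ x)
          - inner ℝ (fderiv ℝ U (φ x) (pd j φ x)) (pd l φ x)) := by
  rw [h.pd_frame hx k i]
  generalize (inner ℝ (pd k (pd i φ) x) (N (φ x)) : ℝ) = c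
  simp only [map_add, map_sum, map_smul, inner_add_left, inner_add_right, sum_inner, inner_sum,
    inner_smul_left, inner_smul_right, RCLike.conj_to_real, hvort, mul_sub, Finset.sum_sub_distrib]
  ring

/-- Ambient and intrinsic differentiation of `du♭` agree here: the Christoffel terms supplied by
`vorticity_gauss` are exactly the corrections in the covariant derivative. -/
lemma cov_extDer_pullback (h : IsNormalPatch φ N V) (hx : x ∈ V)
    (hU : ∀ x ∈ V, ContDiffAt ℝ 2 U (φ x))
    (hvort : ∀ i, inner ℝ (fderiv ℝ U (φ x) (N (φ x))) (pd i φ x)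
      = inner ℝ (fderiv ℝ U (φ x) (pd i φ x)) (N (φ x))) (k i j : Fin n) :
    pd k (fun y => extDer (pullback φ U) y i j) x
        - ∑ l, christoffel (inducedMetric φ) l k i x * extDer (pullback φ U) x l j
        - ∑ l, christoffel (inducedMetric φ) l k j x * extDer (pullback φ U) x i l
      = inner ℝ (fderiv ℝ (fderiv ℝ U) (φ x) (pd k φ x) (pd i φ x)) (pd j φ x)
        - inner ℝ (fderiv ℝ (fderiv ℝ U) (φ x) (pd k φ x) (pd j φ x)) (pd i φ x) := by
  obtain ⟨hd1, h1⟩ := h.pd_inner_fderiv_frame hx (hU x hx) k i j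
  obtain ⟨hd2, h2⟩ := h.pd_inner_fderiv_frame hx (hU x hx) k j i
  rw [pd_congr_on h.isOpen hx fun y hy => h.extDer_pullback hy (hU y hy) i j, pd_sub hd1 hd2,
    h1, h2]
  simp only [h.extDer_pullback hx (hU x hx)]
  rw [← h.vorticity_gauss hx hvort k i j]
  have h3 := h.vorticity_gauss hx hvort k j i
  have h4 : ∑ l, christoffel (inducedMetric φ) l k j x *
        (inner ℝ (fderiv ℝ U (φ x) (pd i φ x)) (pd l φ x)
          - inner ℝ (fderiv ℝ U (φ x) (pd l φ x)) (pd i φ x))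
      = -∑ l, christoffel (inducedMetric φ) l k j x *
        (inner ℝ (fderiv ℝ U (φ x) (pd l φ x)) (pd i φ x)
          - inner ℝ (fderiv ℝ U (φ x) (pd i φ x)) (pd l φ x)) := by
    rw [← Finset.sum_neg_distrib]
    exact Finset.sum_congr rfl fun _ _ => by ring
  rw [h4, ← h3]
  ring

/-- Tangency kills `⟨U, N⟩` times the second fundamental form, so no mean curvature term appears.
Writing the tangential trace as full trace minus normal part over a fixed basis makes it easy to
differentiate. -/
lemma codiffOne_pullback (h : IsNormalPatch φ N V) (hx : x ∈ V) (hU : ContDiffAt ℝ 2 U (φ x))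
    (htan : inner ℝ (U (φ x)) (N (φ x)) = 0) {ι : Type*} [Fintype ι]
    (b : OrthonormalBasis ι ℝ (Amb n)) :
    codiffOne (inducedMetric φ) (pullback φ U) x
      = inner ℝ (fderiv ℝ U (φ x) (N (φ x))) (N (φ x))
        - ∑ a, inner ℝ (fderiv ℝ U (φ x) (b a)) (b a) := by
  have h1 := h.trace_eq hx b ((innerₗ (Amb n)) ∘ₗ (fderiv ℝ U (φ x)).toLinearMap)
  have h2 : ∀ i j, pd i (fun y => pullback φ U y j) x
      - ∑ l, christoffel (inducedMetric φ) l i j x * pullback φ U x l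
      = inner ℝ (fderiv ℝ U (φ x) (pd i φ x)) (pd j φ x) := by
    intro i j
    rw [h.pd_pullback hx hU, h.pd_frame hx i j]
    simp only [inner_add_right, inner_sum, inner_smul_right, htan, pullback]
    ring
  simp only [LinearMap.comp_apply, innerₗ_apply_apply, ContinuousLinearMap.coe_coe] at h1
  unfold codiffOne
  simp only [h2]
  rw [h1]; ring

/-- The tangential part of the ambient Laplacian of a field without tangential vorticity. -/
theorem inner_ambientBochner (h : IsNormalPatch φ N V) (hx : x ∈ V)
    (hU : ∀ x ∈ V, ContDiffAt ℝ 2 U (φ x)) (htan : ∀ x ∈ V, inner ℝ (U (φ x)) (N (φ x)) = 0)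
    (hvort : ∀ i, inner ℝ (fderiv ℝ U (φ x) (N (φ x))) (pd i φ x)
      = inner ℝ (fderiv ℝ U (φ x) (pd i φ x)) (N (φ x))) (m : Fin n)
    (hsecond : inner ℝ (fderiv ℝ (fderiv ℝ U) (φ x) (N (φ x)) (N (φ x))) (pd m φ x)
      + 2 * inner ℝ (fderiv ℝ U (φ x) (N (φ x))) (pd m (fun y => N (φ y)) x) = 0) :
    inner ℝ (ambientBochner U (φ x)) (pd m φ x)
      = -(pd m (codiffOne (inducedMetric φ) (pullback φ U)) x
        + codiffTwo (inducedMetric φ) (extDer (pullback φ U)) x m) := by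
  set D := fderiv ℝ (fderiv ℝ U) (φ x) with hD
  set b := EuclideanSpace.basisFun (Fin (n + 1)) ℝ
  have hdd : DifferentiableAt ℝ (fderiv ℝ U) (φ x) :=
    ((hU x hx).fderiv_right (m := 1) le_rfl).differentiableAt one_ne_zero
  have hP : DifferentiableAt ℝ (fun y => fderiv ℝ U (φ y)) x := hdd.comp x (h.differentiableAt hx)
  have hsymm : ∀ X Y, D X Y = D Y X := fun X Y => (hU x hx).isSymmSndFDerivAt (by simp) X Y
  -- the trace of the second derivative in the adapted frame
  have hlap : inner ℝ (ambientBochner U (φ x)) (pd m φ x)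
      = ∑ i, ∑ j, (inducedMetric φ x)⁻¹ i j * inner ℝ (D (pd i φ x) (pd j φ x)) (pd m φ x)
        + inner ℝ (D (N (φ x)) (N (φ x))) (pd m φ x) := by
    rw [ambientBochner_eq_sum U b, sum_inner]
    exact h.trace_eq hx b (LinearMap.mk₂ ℝ (fun X Y => inner ℝ (D X Y) (pd m φ x))
      (by simp [inner_add_left]) (by simp [inner_smul_left]) (by simp [inner_add_left])
      (by simp [inner_smul_left]))
  have htr : ∑ a, inner ℝ (D (pd m φ x) (b a)) (b a)
      = ∑ i, ∑ j, (inducedMetric φ x)⁻¹ i j * inner ℝ (D (pd m φ x) (pd i φ x)) (pd j φ x)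
        + inner ℝ (D (pd m φ x) (N (φ x))) (N (φ x)) :=
    h.trace_eq hx b ((innerₗ (Amb n)) ∘ₗ (D (pd m φ x)).toLinearMap)
  -- the derivative of the divergence
  have hc : pd m (codiffOne (inducedMetric φ) (pullback φ U)) x
      = inner ℝ (D (pd m φ x) (N (φ x))) (N (φ x))
        + inner ℝ (fderiv ℝ U (φ x) (pd m (fun y => N (φ y)) x)) (N (φ x))
        + inner ℝ (fderiv ℝ U (φ x) (N (φ x))) (pd m (fun y => N (φ y)) x)
        - ∑ a, inner ℝ (D (pd m φ x) (b a)) (b a) := by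
    have hPb : ∀ a, DifferentiableAt ℝ (fun y => fderiv ℝ U (φ y) (b a)) x := fun a =>
      hP.clm_apply (differentiableAt_const _)
    have hν := h.differentiableAt_normal hx
    have hPν := hP.clm_apply hν
    rw [pd_congr_on h.isOpen hx fun y hy => h.codiffOne_pullback hy (hU y hy) (htan y hy) b,
      pd_sub (hPν.inner ℝ hν) (DifferentiableAt.fun_sum fun a _ =>
        (hPb a).inner ℝ (differentiableAt_const _)),
      pd_sum fun a _ => (hPb a).inner ℝ (differentiableAt_const _),
      pd_inner hPν hν, pd_clm_apply hP hν, pd_comp hdd (h.differentiableAt hx), inner_add_left]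
    congr 1
    refine Finset.sum_congr rfl fun a _ => ?_
    rw [pd_inner (hPb a) (differentiableAt_const _), pd_clm_apply hP (differentiableAt_const _),
      pd_comp hdd (h.differentiableAt hx), pd_const]
    simp [D]
  -- `∂ₘN` is tangential by Weingarten, so zero vorticity swaps it with `N`; this produces the
  -- factor `2` matched by `hsecond`.
  have hνν : inner ℝ (fderiv ℝ U (φ x) (pd m (fun y => N (φ y)) x)) (N (φ x))
      = inner ℝ (fderiv ℝ U (φ x) (N (φ x))) (pd m (fun y => N (φ y)) x) := by
    rw [h.pd_normal hx m]
    simp [inner_neg_left, inner_neg_right, sum_inner, inner_sum, inner_smul_left,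
      inner_smul_right, hvort]
  rw [hlap, hc, htr, hνν]
  unfold codiffTwo
  simp only [h.cov_extDer_pullback hx hU hvort, mul_sub, Finset.sum_sub_distrib]
  have h5 : ∑ i, ∑ j, (inducedMetric φ x)⁻¹ i j * inner ℝ (D (pd i φ x) (pd m φ x)) (pd j φ x)
      = ∑ i, ∑ j, (inducedMetric φ x)⁻¹ i j * inner ℝ (D (pd m φ x) (pd i φ x)) (pd j φ x) := by
    simp only [hsymm _ (pd m φ x)]
  rw [h5]
  -- The terms `⟨D²U(∂ₘφ, N), N⟩` cancel inside `dδ`, the mixed tangential traces cancel between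
  -- `dδ` and `δd`, and `hsecond` trades the rest for the normal second derivative.
  linarith

/-- Tangential fields whose covariant components are constant along normals have vanishing
tangential vorticity. -/
lemma vorticity_eq_zero (h : IsNormalPatch φ N V) (hx : x ∈ V) (hU : ContDiffAt ℝ 2 U (φ x))
    (htan : ∀ x ∈ V, inner ℝ (U (φ x)) (N (φ x)) = 0) (i : Fin n)
    (hfirst : inner ℝ (fderiv ℝ U (φ x) (N (φ x))) (pd i φ x)
      + inner ℝ (U (φ x)) (pd i (fun y => N (φ y)) x) = 0) :
    inner ℝ (fderiv ℝ U (φ x) (N (φ x))) (pd i φ x)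
      = inner ℝ (fderiv ℝ U (φ x) (pd i φ x)) (N (φ x)) := by
  have hd := hU.differentiableAt (by simp)
  have hUφ : DifferentiableAt ℝ (fun y => U (φ y)) x := hd.comp x (h.differentiableAt hx)
  have h1 := pd_inner (i := i) hUφ (h.differentiableAt_normal hx)
  rw [pd_congr_on h.isOpen hx htan, pd_const, pd_comp hd (h.differentiableAt hx)] at h1
  linarith

end IsNormalPatch

end ThinShell
-- The normal profile of the contravariant components and the thin-shell limit.
namespace ThinShell

/-- Derivatives at `0` of a function satisfying `f r = c + 2 r a(r) - r² b(r)` near `0`. -/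
lemma derivs_of_eventuallyEq {f a b : ℝ → ℝ} {c : ℝ} (ha : ContDiffAt ℝ 2 a 0)
    (hb : ContDiffAt ℝ 2 b 0) (h : f =ᶠ[𝓝 0] fun r => c + 2 * r * a r - r ^ 2 * b r) :
    deriv f 0 = 2 * a 0 ∧ iteratedDeriv 2 f 0 = 4 * deriv a 0 - 2 * b 0 := by
  have hdiff : ∀ {k : ℝ → ℝ}, ContDiffAt ℝ 2 k 0 → ∀ᶠ r in 𝓝 0, DifferentiableAt ℝ k r :=
    fun hk => (hk.eventually (by simp)).mono fun r hr => hr.differentiableAt (by simp)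
  have hd : ∀ {k : ℝ → ℝ}, ContDiffAt ℝ 2 k 0 → DifferentiableAt ℝ (deriv k) 0 := fun hk =>
    ((hk.fderiv_right (m := 1) le_rfl).clm_apply contDiffAt_const).differentiableAt one_ne_zero
  have h1 : deriv f =ᶠ[𝓝 0] fun r => (2 * a r + 2 * r * deriv a r)
      - (2 * r * b r + r ^ 2 * deriv b r) := by
    filter_upwards [h.eventuallyEq_nhds, hdiff ha, hdiff hb] with r hr har hbr
    rw [hr.deriv_eq]
    have h2 := (((hasDerivAt_id' r).const_mul 2).mul har.hasDerivAt).const_add c |>.sub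
      (((hasDerivAt_id' r).pow 2).mul hbr.hasDerivAt)
    refine (HasDerivAt.congr_deriv h2 ?_).deriv
    simp
  refine ⟨by rw [h1.self_of_nhds]; simp, ?_⟩
  rw [iteratedDeriv_succ, iteratedDeriv_one, h1.deriv_eq]
  have ha0 := (hdiff ha).self_of_nhds.hasDerivAt
  have hb0 := (hdiff hb).self_of_nhds.hasDerivAt
  have h2 := ((ha0.const_mul 2).add
    (((hasDerivAt_id' (0 : ℝ)).const_mul 2).mul (hd ha).hasDerivAt)).sub
    ((((hasDerivAt_id' (0 : ℝ)).const_mul 2).mul hb0).add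
      (((hasDerivAt_id' (0 : ℝ)).pow 2).mul (hd hb).hasDerivAt))
  refine (HasDerivAt.congr_deriv h2 ?_).deriv
  simp
  ring

/-- On a product neighbourhood of `(0, x)` both `F r y` and `F 0 y` lie within `ε / 2` of `F 0 x`,
so continuity at points with `r = 0` suffices. -/
lemma tendstoLocallyUniformlyOn_of_continuousAt {X : Type*} [TopologicalSpace X] {F : ℝ → X → ℝ}
    {V : Set X} (h : ∀ x ∈ V, ContinuousAt (fun p : ℝ × X => F p.1 p.2) (0, x)) :
    TendstoLocallyUniformlyOn F (F 0) (𝓝 0) V := by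
  rw [Metric.tendstoLocallyUniformlyOn_iff]
  intro ε hε x hx
  have h1 := Metric.tendsto_nhds.1 (h x hx) (ε / 2) (half_pos hε)
  rw [nhds_prod_eq] at h1
  obtain ⟨pa, ha, pb, hb, hab⟩ := Filter.eventually_prod_iff.1 h1
  refine ⟨{y | pb y}, mem_nhdsWithin_of_mem_nhds hb, ?_⟩
  filter_upwards [ha] with r hr y hy
  have h2 := hab hr hy
  have h3 := hab ha.self_of_nhds hy
  rw [dist_comm] at h2
  have h4 := dist_triangle_left (F 0 y) (F r y) (F 0 x)
  rw [dist_comm] at h3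
  linarith

namespace IsNormalPatch

variable {n : ℕ} {φ : Coord n → Amb n} {N : Amb n → Amb n} {V : Set (Coord n)} {x : Coord n}
  {U X : Amb n → Amb n}

/-- The Fermi vectors are `(1 - rS)∂ᵢφ`, and self-adjointness of `S` gathers both factors on one
side: `g(r) = g(0)(1 - rS)²`. -/
lemma fermiMetric_eq (h : IsNormalPatch φ N V) (hx : x ∈ V) (r : ℝ) :
    fermiMetric φ N r x = inducedMetric φ x *
      (1 - (2 * r) • shape φ N x + r ^ 2 • shape φ N x ^ 2) := by
  have h1 : ∀ i j, (inducedMetric φ x * shape φ N x) i j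
      = -inner ℝ (pd i φ x) (pd j (fun y => N (φ y)) x) := by
    intro i j
    rw [h.pd_normal hx j, Matrix.mul_apply, inner_neg_right, neg_neg, inner_sum]
    refine Finset.sum_congr rfl fun l _ => ?_
    rw [inner_smul_right, mul_comm]; rfl
  have h2 : ∀ i j, (inducedMetric φ x * shape φ N x ^ 2) i j
      = inner ℝ (pd i (fun y => N (φ y)) x) (pd j (fun y => N (φ y)) x) := by
    intro i j
    conv_rhs => rw [h.pd_normal hx j, inner_neg_right, inner_sum, ← Finset.sum_neg_distrib]
    rw [pow_two, ← Matrix.mul_assoc, Matrix.mul_apply]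
    refine Finset.sum_congr rfl fun l _ => ?_
    rw [h1, inner_smul_right, h.inner_pd_normal_symm hx i l, real_inner_comm]
    ring
  ext i j
  have h3 : inducedMetric φ x * (1 - (2 * r) • shape φ N x + r ^ 2 • shape φ N x ^ 2)
      = inducedMetric φ x - (2 * r) • (inducedMetric φ x * shape φ N x)
        + r ^ 2 • (inducedMetric φ x * shape φ N x ^ 2) := by
    rw [mul_add, mul_sub, mul_one, mul_smul_comm, mul_smul_comm]
  rw [h3, Matrix.add_apply, Matrix.sub_apply, Matrix.smul_apply, Matrix.smul_apply, h1, h2,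
    smul_eq_mul, smul_eq_mul]
  have h4 : fermiMetric φ N r x i j = inner ℝ (fermiVec φ N r x i) (fermiVec φ N r x j) := rfl
  have h5 : inducedMetric φ x i j = inner ℝ (pd i φ x) (pd j φ x) := rfl
  rw [h4, h5, h.fermiVec_eq hx, h.fermiVec_eq hx]
  simp only [inner_add_left, inner_add_right, inner_smul_left, inner_smul_right,
    RCLike.conj_to_real]
  rw [h.inner_pd_normal_symm hx i j, real_inner_comm (pd i φ x)]
  ring

lemma contDiffAt_fermiVec (h : IsNormalPatch φ N V) (hx : x ∈ V) (i : Fin n) :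
    ContDiffAt ℝ ∞ (fun p : ℝ × Coord n => fermiVec φ N p.1 p.2 i) (0, x) := by
  have hV : ∀ᶠ p : ℝ × Coord n in 𝓝 (0, x), p.2 ∈ V :=
    continuousAt_snd.eventually (h.isOpen.mem_nhds hx)
  have h1 : ContDiffAt ℝ ∞
      (fun p : ℝ × Coord n => pd i φ p.2 + p.1 • pd i (fun y => N (φ y)) p.2) (0, x) :=
    ((h.contDiffAt_frame hx i).comp ((0 : ℝ), x) contDiffAt_snd).add
      (contDiffAt_fst.smul ((h.contDiffAt_pd_normal hx i).comp ((0 : ℝ), x) contDiffAt_snd))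
  exact h1.congr_of_eventuallyEq (hV.mono fun p hp => h.fermiVec_eq hp p.1 i)

lemma contDiffAt_fermiMetric_inv (h : IsNormalPatch φ N V) (hx : x ∈ V) (i j : Fin n) :
    ContDiffAt ℝ ∞ (fun p : ℝ × Coord n => (fermiMetric φ N p.1 p.2)⁻¹ i j) (0, x) := by
  refine contDiffAt_inv_apply (A := fun p : ℝ × Coord n => fermiMetric φ N p.1 p.2)
    (fun i j => (h.contDiffAt_fermiVec hx i).inner ℝ (h.contDiffAt_fermiVec hx j)) ?_ i j
  rw [fermiMetric_zero]
  exact h.isMetricOn.det_ne_zero x hx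

lemma continuousAt_upperComp (h : IsNormalPatch φ N V) (hx : x ∈ V)
    (hX : ContinuousAt X (φ x)) (i : Fin n) :
    ContinuousAt (fun p : ℝ × Coord n => upperComp φ N X p.1 p.2 i) (0, x) := by
  have hf : ContinuousAt (fun p : ℝ × Coord n => fermi φ N p.1 p.2) (0, x) :=
    (ContinuousAt.comp (f := Prod.snd) (x := ((0 : ℝ), x)) (h.smooth x hx).continuousAt
      continuousAt_snd).add (continuousAt_fst.smul (ContinuousAt.comp (f := Prod.snd)
        (x := ((0 : ℝ), x)) (h.smooth_normal x hx).continuousAt continuousAt_snd))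
  have hX' : ContinuousAt X (fermi φ N 0 x) := by rwa [fermi_zero]
  refine tendsto_finsetSum _ fun j _ => ?_
  exact (h.contDiffAt_fermiMetric_inv hx i j).continuousAt.mul
    ((ContinuousAt.comp (x := ((0 : ℝ), x)) hX' hf).inner
      (h.contDiffAt_fermiVec hx j).continuousAt)

lemma lowerComp_eq (h : IsNormalPatch φ N V) (hx : x ∈ V) (i : Fin n) :
    (fun r => lowerComp φ N X r x i) = fun r : ℝ => (inner ℝ (X (φ x + r • N (φ x)))
      (pd i φ x + r • pd i (fun y => N (φ y)) x) : ℝ) := by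
  funext r
  rw [lowerComp, h.fermiVec_eq hx]; rfl

lemma contDiffAt_upperComp_zero (h : IsNormalPatch φ N V) (hx : x ∈ V)
    (hU : ContDiffAt ℝ 2 U (φ x)) (i : Fin n) :
    ContDiffAt ℝ 2 (fun y => upperComp φ N U 0 y i) x := by
  simp only [upperComp, fermiMetric_zero, lowerComp_zero]
  refine ContDiffAt.sum fun j _ => ?_
  refine ((h.isMetricOn.contDiffAt_inv hx i j).of_le ENat.LEInfty.out).mul ?_
  exact (hU.comp x ((h.smooth x hx).of_le ENat.LEInfty.out)).inner ℝ
    ((h.contDiffAt_frame hx j).of_le ENat.LEInfty.out)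

lemma contDiffAt_upperComp_normal (h : IsNormalPatch φ N V) (hx : x ∈ V)
    (hU : ContDiffAt ℝ 2 U (φ x)) (i : Fin n) :
    ContDiffAt ℝ 2 (fun r => upperComp φ N U r x i) 0 := by
  refine ContDiffAt.sum fun j _ => ?_
  refine ContDiffAt.mul ?_ ?_
  · exact ((h.contDiffAt_fermiMetric_inv hx i j).of_le ENat.LEInfty.out).comp (0 : ℝ)
      (f := fun r : ℝ => (r, x)) (contDiffAt_id.prodMk contDiffAt_const)
  · rw [h.lowerComp_eq hx]
    exact contDiffAt_normalLine hU

/-- The contravariant components along a normal line, when the covariant ones are constant. -/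
lemma upperComp_normal_relation (h : IsNormalPatch φ N V) (hx : x ∈ V)
    (hconst : ∀ i, ∀ᶠ r in 𝓝 (0 : ℝ), lowerComp φ N U r x i = lowerComp φ N U 0 x i) (i : Fin n) :
    (fun r => upperComp φ N U r x i) =ᶠ[𝓝 0] fun r => upperComp φ N U 0 x i
      + 2 * r * (shape φ N x).mulVec (upperComp φ N U r x) i
      - r ^ 2 * (shape φ N x ^ 2).mulVec (upperComp φ N U r x) i := by
  have hdet : ∀ᶠ r in 𝓝 (0 : ℝ), (fermiMetric φ N r x).det ≠ 0 := by
    have h1 : ContDiffAt ℝ ∞ (fun p : ℝ × Coord n => (fermiMetric φ N p.1 p.2).det) (0, x) :=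
      contDiffAt_det
        fun i j => (h.contDiffAt_fermiVec hx i).inner ℝ (h.contDiffAt_fermiVec hx j)
    have h2 : ContinuousAt (fun r : ℝ => (fermiMetric φ N r x).det) 0 :=
      ContinuousAt.comp (f := fun r : ℝ => (r, x)) h1.continuousAt (by fun_prop)
    refine h2.eventually_ne ?_
    rw [fermiMetric_zero]
    exact h.isMetricOn.det_ne_zero x hx
  have hmul : ∀ r, (fermiMetric φ N r x).det ≠ 0 →
      (fermiMetric φ N r x).mulVec (upperComp φ N U r x) = lowerComp φ N U r x := by
    intro r hr
    have : upperComp φ N U r x = (fermiMetric φ N r x)⁻¹.mulVec (lowerComp φ N U r x) := rfl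
    rw [this, Matrix.mulVec_mulVec, Matrix.mul_nonsing_inv _ hr.isUnit, Matrix.one_mulVec]
  filter_upwards [hdet, Filter.eventually_all.2 hconst] with r hr hc
  have h1 := hmul r hr
  rw [funext hc, ← hmul 0 hdet.self_of_nhds, h.fermiMetric_eq hx r, fermiMetric_zero,
    ← Matrix.mulVec_mulVec] at h1
  -- `h1` says `g(0)(1 - 2rS + r²S²)u(r) = g(0)u(0)`; cancelling `g(0)` leaves the relation.
  have h2 := congrArg (inducedMetric φ x)⁻¹.mulVec h1
  rw [Matrix.mulVec_mulVec, Matrix.mulVec_mulVec,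
    Matrix.nonsing_inv_mul _ (h.isMetricOn.isUnit_det hx), Matrix.one_mul,
    Matrix.mulVec_mulVec, Matrix.nonsing_inv_mul _ (h.isMetricOn.isUnit_det hx),
    Matrix.one_mulVec] at h2
  rw [← h2]
  simp only [Matrix.add_mulVec, Matrix.sub_mulVec, Matrix.one_mulVec, Matrix.smul_mulVec,
    Pi.add_apply, Pi.sub_apply, Pi.smul_apply, smul_eq_mul]
  ring

theorem upperComp_normal_derivs (h : IsNormalPatch φ N V) (hx : x ∈ V)
    (hU : ContDiffAt ℝ 2 U (φ x))
    (hconst : ∀ i, ∀ᶠ r in 𝓝 (0 : ℝ), lowerComp φ N U r x i = lowerComp φ N U 0 x i) (i : Fin n) :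
    deriv (fun r => upperComp φ N U r x i) 0
        = 2 * (shape φ N x).mulVec (upperComp φ N U 0 x) i ∧
    iteratedDeriv 2 (fun r => upperComp φ N U r x i) 0
        = 6 * (shape φ N x ^ 2).mulVec (upperComp φ N U 0 x) i := by
  have hu := h.contDiffAt_upperComp_normal hx hU
  have hA : ∀ (A : Matrix (Fin n) (Fin n) ℝ) i,
      ContDiffAt ℝ 2 (fun r => A.mulVec (upperComp φ N U r x) i) 0 := fun A i => by
    simp only [Matrix.mulVec, dotProduct]
    exact ContDiffAt.sum fun j _ => contDiffAt_const.mul (hu j)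
  -- The relation is implicit, as its coefficient functions involve `u(r)` itself; it may be
  -- differentiated because `u(r)` is already known to be `C²`.
  have key := fun i => derivs_of_eventuallyEq (hA (shape φ N x) i) (hA (shape φ N x ^ 2) i)
    (h.upperComp_normal_relation hx hconst i)
  refine ⟨(key i).1, ?_⟩
  have hd : deriv (fun r => (shape φ N x).mulVec (upperComp φ N U r x) i) 0
      = 2 * (shape φ N x ^ 2).mulVec (upperComp φ N U 0 x) i := by
    have h1 : HasDerivAt (fun r => (shape φ N x).mulVec (upperComp φ N U r x) i)
        (∑ j, shape φ N x i j * (2 * (shape φ N x).mulVec (upperComp φ N U 0 x) j)) 0 := by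
      simp only [← fun j => (key j).1]
      unfold Matrix.mulVec dotProduct
      exact HasDerivAt.fun_sum fun j _ =>
        ((hu j).differentiableAt (by simp)).hasDerivAt.const_mul _
    rw [h1.deriv, pow_two, ← Matrix.mulVec_mulVec]
    simp only [Matrix.mulVec, dotProduct, Finset.mul_sum]
    exact Finset.sum_congr rfl fun _ _ => Finset.sum_congr rfl fun _ _ => by ring
  -- Here `4 · 2S² - 2S² = 6S²`.
  rw [(key i).2, hd]
  ring

end IsNormalPatch

end ThinShell

/-! ### Assembly of the theorem. -/

theorem theorem2 (n : ℕ) (M : Set (ThinShell.Amb n)) (hM : ThinShell.IsSmoothHypersurface M)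
    (N : ThinShell.Amb n → ThinShell.Amb n) (hN : ThinShell.IsUnitNormal M N)
    (Ω : Set (ThinShell.Amb n)) (hΩ : IsOpen Ω) (hMΩ : M ⊆ Ω)
    (U : ThinShell.Amb n → ThinShell.Amb n) (hU : ContDiffOn ℝ 2 U Ω)
    (htan : ∀ p ∈ M, inner ℝ (U p) (N p) = 0)
    (hHodge : ThinShell.HodgeCondition M N U)
    (φ : ThinShell.Coord n → ThinShell.Amb n) (V : Set (ThinShell.Coord n))
    (hφ : ThinShell.IsLocalParam M φ V) :
    -- the tangential vorticity vanishes on `M`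
    (∀ x ∈ V, ∀ i, ThinShell.tangentialVorticity φ N U x i = 0) ∧
    -- the normal profile of the contravariant components
    (∀ x ∈ V, ∀ i,
      ContDiffAt ℝ 2 (fun r => ThinShell.upperComp φ N U r x i) 0 ∧
      deriv (fun r => ThinShell.upperComp φ N U r x i) 0 =
        2 * ((ThinShell.shape φ N x).mulVec (ThinShell.upperComp φ N U 0 x)) i ∧
      iteratedDeriv 2 (fun r => ThinShell.upperComp φ N U r x i) 0 =
        6 * ((ThinShell.shape φ N x ^ 2).mulVec (ThinShell.upperComp φ N U 0 x)) i) ∧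
    -- the ambient Bochner Laplacian at `r = 0`
    (∀ x ∈ V, ∀ i,
      ThinShell.upperComp φ N (ThinShell.ambientBochner U) 0 x i =
        ThinShell.hodge (ThinShell.inducedMetric φ) (ThinShell.upperComp φ N U 0) x i) ∧
    -- the Hodge Laplacian is `Δ_B - Ric`
    (∀ x ∈ V, ∀ i,
      ThinShell.hodge (ThinShell.inducedMetric φ) (ThinShell.upperComp φ N U 0) x i =
        ThinShell.bochner (ThinShell.inducedMetric φ) (ThinShell.upperComp φ N U 0) x i
          - ThinShell.ricciVec (ThinShell.inducedMetric φ) (ThinShell.upperComp φ N U 0) x i) ∧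
    -- the thin-shell limit, uniformly on compact subsets of `V`
    (∀ i, TendstoLocallyUniformlyOn
      (fun (r : ℝ) (x : ThinShell.Coord n) =>
        ThinShell.upperComp φ N (ThinShell.ambientBochner U) r x i)
      (fun x => ThinShell.hodge (ThinShell.inducedMetric φ) (ThinShell.upperComp φ N U 0) x i)
      (𝓝 0) V) := by
  have h := hφ.isNormalPatch hN
  have hU' : ∀ x ∈ V, ContDiffAt ℝ 2 U (φ x) := fun x hx =>
    hU.contDiffAt (hΩ.mem_nhds (hMΩ (hφ.mem hx)))
  have htan' : ∀ x ∈ V, inner ℝ (U (φ x)) (N (φ x)) = 0 := fun x hx => htan _ (hφ.mem hx)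
  have hline := fun x hx i => by
    have h1 := hHodge φ V hφ x hx i
    rw [h.lowerComp_eq hx] at h1
    exact h1
  have hvort : ∀ x ∈ V, ∀ i, inner ℝ (fderiv ℝ U (φ x) (N (φ x))) (ThinShell.pd i φ x)
      = inner ℝ (fderiv ℝ U (φ x) (ThinShell.pd i φ x)) (N (φ x)) := fun x hx i =>
    h.vorticity_eq_zero hx (hU' x hx) htan' i
      (ThinShell.normalLine_first_order (hU' x hx) (hline x hx i))
  have hconst : ∀ x ∈ V, ∀ i, ∀ᶠ r in 𝓝 (0 : ℝ),
      ThinShell.lowerComp φ N U r x i = ThinShell.lowerComp φ N U 0 x i := by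
    intro x hx i
    filter_upwards [ThinShell.normalLine_const (hU' x hx) (hline x hx i)] with r hr
    rw [ThinShell.lowerComp_zero, ← hr]
    exact congrFun (h.lowerComp_eq hx i) r
  have hflat : ∀ x ∈ V, ∀ i,
      ThinShell.flat (ThinShell.inducedMetric φ) (ThinShell.upperComp φ N U 0) x i
        = ThinShell.pullback φ U x i := fun x hx i => h.flat_upperComp_zero hx U i
  have hlap : ∀ x ∈ V, ∀ i, ThinShell.upperComp φ N (ThinShell.ambientBochner U) 0 x i =
      ThinShell.hodge (ThinShell.inducedMetric φ) (ThinShell.upperComp φ N U 0) x i := by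
    intro x hx i
    unfold ThinShell.upperComp ThinShell.hodge
    rw [ThinShell.fermiMetric_zero, ← Finset.sum_neg_distrib]
    refine Finset.sum_congr rfl fun j _ => ?_
    rw [ThinShell.lowerComp_zero, h.inner_ambientBochner hx hU' htan' (hvort x hx) j
      (ThinShell.normalLine_second_order (hU' x hx) (hline x hx j)), mul_neg]
    -- `u♭` and the pullback agree only over `V`; as `V` is open, the derivatives in both
    -- codifferentials agree there too.
    congr 3
    · exact (ThinShell.pd_congr_on h.isOpen hx fun y hy =>
        ThinShell.codiffOne_congr h.isOpen hy hflat).symm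
    · exact (ThinShell.codiffTwo_congr h.isOpen hx (fun y hy =>
        ThinShell.extDer_congr h.isOpen hy hflat) j).symm
  refine ⟨fun x hx i => sub_eq_zero.2 (hvort x hx i), fun x hx i =>
    ⟨h.contDiffAt_upperComp_normal hx (hU' x hx) i,
      h.upperComp_normal_derivs hx (hU' x hx) (hconst x hx) i⟩, hlap, fun x hx i =>
    h.isMetricOn.hodge_eq_bochner_sub_ricci hx
      (fun y hy j => h.contDiffAt_upperComp_zero hy (hU' y hy) j) i, fun i => ?_⟩
  -- The limit is first obtained as the value at `r = 0`, then identified by `hlap`. For `U` of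
  -- class `C²` the ambient Laplacian is continuous, which is all this needs.
  exact (ThinShell.tendstoLocallyUniformlyOn_of_continuousAt fun x hx =>
    h.continuousAt_upperComp hx (ThinShell.continuousAt_ambientBochner (hU' x hx)) i).congr_right
      fun x hx => hlap x hx i
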